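/- For an integer $n\ge 2$ and a permutation $\pi$ of $\{1,\dots,n\}$, let $\mathrm{mj}(\pi)=\min_{1\le i\le n-1}|\pi(i+1)-\pi(i)|$ be the minimum jump of $\pi$. Let $t$ be a fixed positive integer. There exist real-valued functions $p_1,\dots,p_{t-1},q$ on the non-negative integers, depending only on $t$ and each bounded in absolute value by a polynomial, with the following property. For a permutation $\pi$ of $\{1,\dots,n\}$ chosen uniformly at random, \[ \Pr[\mathrm{mj}(\pi)\ge d+1]=\Bigl(1+\sum_{i=1}^{t-1}\frac{p_i(d)}{n^i}\Bigr)e^{-2d}+O\!\Bigl(\frac{q(d)\,e^{2d}}{n^t}\Bigr)\qquad (n\to\infty) \] uniformly over non-negative integers $d=O(\log n)$; that is, for every real $C$ there are a constant $A$ and an integer $N$, depending only on $t$ and $C$, such that for all $n\ge N$ and all integers $d$ with $0\le d\le C\log n$ the error term is at most $A\,|q(d)|\,e^{2d}/n^t$ in absolute value. -/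

import Mathlib

/-- The minimum jump of a permutation `π` of an `n`-element interval of integers: the minimum of
`|π (i + 1) - π i|` over all pairs of consecutive positions. The set below is nonempty when
`2 ≤ n`, so that its infimum is then a minimum. -/
noncomputable def minJump {n : ℕ} (π : Equiv.Perm (Fin n)) : ℕ :=
  sInf {k : ℕ | ∃ i j : Fin n, (j : ℕ) = (i : ℕ) + 1 ∧
    k = (((π j : ℕ) : ℤ) - ((π i : ℕ) : ℤ)).natAbs}

/-- The probability that a uniformly random permutation `π` of `n` points satisfies
`minJump π ≥ k`. -/
noncomputable def probMinJumpGe (n k : ℕ) : ℝ :=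
  ((Finset.univ.filter fun π : Equiv.Perm (Fin n) => k ≤ minJump π).card : ℝ) /
    (Fintype.card (Equiv.Perm (Fin n)) : ℝ)

/-- A function on the nonnegative integers is polynomially bounded if its absolute value is at most
a polynomial. -/
def PolynomiallyBounded (f : ℕ → ℝ) : Prop :=
  ∃ P : Polynomial ℝ, ∀ x : ℕ, |f x| ≤ P.eval (x : ℝ)

/-! The event says that no pair of consecutive entries is a short arc, that is, an ordered pair of
distinct values at distance at most `d`. Inclusion–exclusion over sets of arcs keeps only the sets
occurring together in some word, the linear forests. One with `k` arcs lies in `(n - k)!` words, so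
the probability is `∑ (-1)^k f_k / (n)_k`, where `f_k` counts forests with `k` arcs and `(n)_k` is
the falling factorial (`probMinJumpGe_eq`).

If all `k`-sets of the `m` arcs were forests and `(n)_k` were `n^k`, this would essentially be the
series of `exp (-m / n)`, with `m / n = 2d - d(d+1)/n`. Two corrections have to be expanded in
powers of `1 / n`.

(1) Dependence between arcs. A binomial transform writes `k! f_k = ∑ C(k,b) m^(k-b) g_b`, where
`g_b` sums an alternating weight over `b`-tuples of arcs. The weight vanishes if some arc touches no
other (`tupleWeight_eq_zero`), so surviving tuples are determined up to boundedly many choices by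
about half of their arcs, and `g_b = O(n^⌊b/2⌋)` (`abs_centredCount_le`). Hence clusters with `b ≥
2t` arcs cost only `O(n^(-t))`. For fixed `d`, cutting forests at uncrossed gaps shows that `f_k`,
hence `g_b`, is a polynomial in `n` from an explicit threshold on. Its degree is at most `⌊b/2⌋` by
the growth bound, so Lagrange interpolation just above the threshold controls its coefficients
polynomially in `d`.

(2) The falling factorial. `n^k / (n)_k` expands in `1 / n` with coefficients polynomial in `k`
(`pow_div_descFactorial_expansion`), valid for `2k² ≤ n`. Summed against `(-y)^l / l!`, with `y = m
/ n`, a polynomial in `l` yields a polynomial in `y` times `exp (-y)` (`exists_hasSum_exp`).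

The sum over `k` is therefore truncated at some `κ` of order `log n`, beyond which the terms are
negligible. The errors in (1) and (2) are estimated with absolute values, which turns `exp (-y)`
into `exp y ≤ exp (2d)`; this is the source of the factor `e^(2d)` in the error. -/

/-! ### Words in which prescribed arcs are consecutive -/

/-- The arrangements of the elements of `V` in a row. -/
noncomputable def words (V : Finset ℕ) : Finset (List ℕ) := V.toList.permutations.toFinset

theorem mem_words {V : Finset ℕ} {l : List ℕ} : l ∈ words V ↔ l.Nodup ∧ l.toFinset = V := by
  simp only [words, List.mem_toFinset, List.mem_permutations]
  constructor
  · intro h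
    refine ⟨h.nodup_iff.2 V.nodup_toList, ?_⟩
    rw [List.toFinset_eq_of_perm _ _ h, Finset.toList_toFinset]
  · rintro ⟨h, rfl⟩
    exact (List.toFinset_toList h).symm

theorem card_words (V : Finset ℕ) : (words V).card = V.card.factorial := by
  rw [words, List.toFinset_card_of_nodup (List.nodup_permutations _ V.nodup_toList),
    List.length_permutations, Finset.length_toList]

/-- A finite set of arcs is a linear forest if its arcs are consecutive in a common word without
repetitions. -/
def LinForest (A : Finset (ℕ × ℕ)) : Prop :=
  ∃ l : List ℕ, l.Nodup ∧ ∀ e ∈ A, [e.1, e.2] <:+: l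

theorem LinForest.mono {A B : Finset (ℕ × ℕ)} (h : A ⊆ B) (hB : LinForest B) : LinForest A := by
  obtain ⟨l, hl, h'⟩ := hB
  exact ⟨l, hl, fun e he => h' e (h he)⟩

theorem linForest_empty : LinForest ∅ := ⟨[], by simp, by simp⟩

theorem LinForest.ne {A : Finset (ℕ × ℕ)} (hA : LinForest A) {e : ℕ × ℕ} (he : e ∈ A) :
    e.1 ≠ e.2 := by
  obtain ⟨l, hl, h⟩ := hA
  have := (h e he).sublist.nodup hl
  simpa using this

theorem mem_of_pair_infix {l : List ℕ} {x y : ℕ} (h : [x, y] <:+: l) : x ∈ l ∧ y ∈ l :=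
  ⟨h.subset (by simp), h.subset (by simp)⟩

theorem idxOf_of_pair_infix {l : List ℕ} (hl : l.Nodup) {x y : ℕ} (h : [x, y] <:+: l) :
    l.idxOf y = l.idxOf x + 1 := by
  obtain ⟨s, t, rfl⟩ := h
  have hx : x ∉ s := by
    intro hx
    simp only [List.append_assoc, List.nodup_append] at hl
    exact hl.2.2 x hx x (by simp) rfl
  have hy : y ∉ s := by
    intro hx
    simp only [List.append_assoc, List.nodup_append] at hl
    exact hl.2.2 y hx y (by simp) rfl
  have hxy : x ≠ y := by
    rintro rfl
    simp [List.nodup_append] at hl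
  simp [List.append_assoc, List.idxOf_append, hx, hy, hxy, add_comm]

/-- A nonempty linear forest has an initial arc: no arc enters its source, and no other arc
meets its source or enters its target. -/
theorem LinForest.exists_initial {A : Finset (ℕ × ℕ)} (hA : LinForest A) (hne : A.Nonempty) :
    ∃ e ∈ A, (∀ e' ∈ A, e'.2 ≠ e.1) ∧ ∀ e' ∈ A, e' ≠ e → e'.1 ≠ e.1 ∧ e'.2 ≠ e.2 := by
  obtain ⟨l, hl, h⟩ := hA
  -- The initial arc is the one whose source comes earliest in the word.
  obtain ⟨e, he, hmin⟩ := A.exists_min_image (fun e => l.idxOf e.1) hne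
  refine ⟨e, he, ?_, ?_⟩
  · intro e' he' heq
    have h1 := idxOf_of_pair_infix hl (h e' he')
    have h2 := hmin e' he'
    rw [heq] at h1
    omega
  · intro e' he' hne'
    have h1 := idxOf_of_pair_infix hl (h e' he')
    have h2 := idxOf_of_pair_infix hl (h e he)
    constructor
    · intro heq
      apply hne'
      rw [heq, ← h2] at h1
      exact Prod.ext heq ((List.idxOf_inj (mem_of_pair_infix (h e' he')).2).1 h1)
    · intro heq
      apply hne'
      rw [heq, h2] at h1
      exact Prod.ext ((List.idxOf_inj (mem_of_pair_infix (h e' he')).1).1 (by omega)) heq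

open Classical in
/-- The words on `V` in which every arc of `A` is consecutive. -/
noncomputable def wordsThrough (V : Finset ℕ) (A : Finset (ℕ × ℕ)) : Finset (List ℕ) :=
  (words V).filter fun l => ∀ e ∈ A, [e.1, e.2] <:+: l

theorem mem_wordsThrough {V : Finset ℕ} {A : Finset (ℕ × ℕ)} {l : List ℕ} :
    l ∈ wordsThrough V A ↔ (l.Nodup ∧ l.toFinset = V) ∧ ∀ e ∈ A, [e.1, e.2] <:+: l := by
  simp [wordsThrough, mem_words]

/-- A letter inserted just before `b` separates only the pair ending in `b`. -/
theorem pair_infix_insert {s t : List ℕ} {a b x y : ℕ} (hy : y ≠ b)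
    (h : [x, y] <:+: s ++ b :: t) : [x, y] <:+: s ++ a :: b :: t := by
  obtain ⟨p, q, hpq⟩ := h
  have hpq' : (p ++ [x]) ++ y :: q = s ++ b :: t := by simpa using hpq
  rcases List.append_eq_append_iff.1 hpq' with ⟨c, hs, ht⟩ | ⟨c, hs, ht⟩
  · rcases c with _ | ⟨z, c⟩
    · simp only [List.nil_append, List.cons.injEq] at ht
      exact absurd ht.1 hy
    · simp only [List.cons_append, List.cons.injEq] at ht
      obtain ⟨rfl, -⟩ := ht
      exact ⟨p, c ++ a :: b :: t, by rw [hs]; simp⟩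
  · rcases c with _ | ⟨z, c⟩
    · simp only [List.nil_append, List.cons.injEq] at ht
      exact absurd ht.1.symm hy
    · simp only [List.cons_append, List.cons.injEq] at ht
      obtain ⟨rfl, rfl⟩ := ht
      have hx : [x] <:+ b :: c := by
        refine List.suffix_of_suffix_length_le (l₃ := p ++ [x]) (List.suffix_append _ _) ?_ (by simp)
        rw [hs]
        exact List.suffix_append _ _
      obtain ⟨w, hw⟩ := hx
      refine ⟨s ++ a :: w, q, ?_⟩
      have : s ++ a :: b :: (c ++ y :: q) = s ++ a :: ((b :: c) ++ y :: q) := by simp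
      rw [this, ← hw]
      simp

theorem erase_append_cons {s t : List ℕ} {a : ℕ} (h : (s ++ a :: t).Nodup) :
    (s ++ a :: t).erase a = s ++ t := by
  have : a ∉ s := by
    intro ha
    exact (List.nodup_append.1 h).2.2 a ha a (by simp) rfl
  rw [List.erase_append_right _ this, List.erase_cons_head]

/-- Contraction of an initial arc: `a` must stand immediately before `b`, so deleting it loses no
information, and reinserting it before `b` breaks no other arc because none ends in `b`. -/
theorem card_wordsThrough_erase {V : Finset ℕ} {A : Finset (ℕ × ℕ)} {a b : ℕ} (hab : (a, b) ∈ A)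
    (hV : ∀ e ∈ A, e.1 ∈ V ∧ e.2 ∈ V) (hne : a ≠ b) (h1 : ∀ e ∈ A, e.2 ≠ a)
    (h2 : ∀ e ∈ A, e ≠ (a, b) → e.1 ≠ a ∧ e.2 ≠ b) :
    (wordsThrough V A).card = (wordsThrough (V.erase a) (A.erase (a, b))).card := by
  refine Finset.card_bij (fun l _ => l.erase a) ?_ ?_ ?_
  · intro l hlw
    obtain ⟨⟨hl, hlV⟩, h⟩ := mem_wordsThrough.1 hlw
    subst hlV
    refine mem_wordsThrough.2 ⟨⟨hl.erase a, ?_⟩, ?_⟩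
    · ext x
      simp [hl.mem_erase_iff]
    · intro e he
      have he' := Finset.mem_erase.1 he
      have := (h e he'.2).filter (fun x => x != a)
      rw [← hl.erase_eq_filter] at this
      simpa [List.filter_cons, (h2 e he'.2 he'.1).1, h1 e he'.2] using this
  · intro l hl l' hl' heq
    obtain ⟨⟨hl, -⟩, h⟩ := mem_wordsThrough.1 hl
    obtain ⟨⟨hl', -⟩, h'⟩ := mem_wordsThrough.1 hl'
    obtain ⟨s, t, rfl⟩ := h _ hab
    obtain ⟨s', t', rfl⟩ := h' _ hab
    simp only [List.append_assoc, List.cons_append, List.nil_append] at heq hl hl' ⊢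
    rw [erase_append_cons hl, erase_append_cons hl'] at heq
    have hb : b ∉ s := fun hb => (List.nodup_append.1 hl).2.2 b hb b (by simp) rfl
    have ht : b ∉ t := by simp [List.nodup_append] at hl; tauto
    obtain ⟨rfl, -, rfl⟩ := (List.append_cons_inj_of_notMem hb ht).1 heq
    rfl
  · intro l hl
    obtain ⟨⟨hl, hlV⟩, h⟩ := mem_wordsThrough.1 hl
    have hbl : b ∈ l := by
      rw [← List.mem_toFinset, hlV]
      exact Finset.mem_erase.2 ⟨hne.symm, (hV _ hab).2⟩
    have hal : a ∉ l := by
      rw [← List.mem_toFinset, hlV]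
      simp
    obtain ⟨s, t, rfl⟩ := List.append_of_mem hbl
    have hn : (s ++ a :: b :: t).Nodup := by
      rw [List.nodup_middle]
      exact List.nodup_cons.2 ⟨hal, hl⟩
    refine ⟨s ++ a :: b :: t, mem_wordsThrough.2 ⟨⟨hn, ?_⟩, ?_⟩, erase_append_cons hn⟩
    · rw [← Finset.insert_erase (hV _ hab).1, ← hlV]
      ext x
      simp
    · intro e he
      by_cases hee : e = (a, b)
      · subst hee
        exact ⟨s, t, by simp⟩
      · exact pair_infix_insert (h2 e he hee).2 (h e (Finset.mem_erase.2 ⟨hee, he⟩))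

/-- Contracting the arcs one at a time, always an initial one, removes one letter per arc; the
remaining letters are then arranged freely. -/
theorem card_wordsThrough {A : Finset (ℕ × ℕ)} (hA : LinForest A) {V : Finset ℕ}
    (hV : ∀ e ∈ A, e.1 ∈ V ∧ e.2 ∈ V) :
    A.card ≤ V.card ∧ (wordsThrough V A).card = (V.card - A.card).factorial := by
  induction hk : A.card generalizing A V with
  | zero =>
    obtain rfl := Finset.card_eq_zero.1 hk
    simp [wordsThrough, card_words]
  | succ k ih =>
    obtain ⟨⟨a, b⟩, he, h1, h2⟩ := hA.exists_initial (Finset.card_pos.1 (by omega))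
    have hVa := (hV _ he).1
    have hcard : (A.erase (a, b)).card = k := by rw [Finset.card_erase_of_mem he]; omega
    have hVc := Finset.card_erase_add_one hVa
    have := ih (hA.mono (Finset.erase_subset (a, b) A)) (V := V.erase a) (by
      intro e he'
      obtain ⟨hne, he'⟩ := Finset.mem_erase.1 he'
      exact ⟨Finset.mem_erase.2 ⟨(h2 e he' hne).1, (hV e he').1⟩,
        Finset.mem_erase.2 ⟨h1 e he', (hV e he').2⟩⟩) hcard
    rw [card_wordsThrough_erase he hV (hA.ne he) h1 h2, this.2]
    dsimp only at hVc
    exact ⟨by omega, by congr 1; omega⟩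

theorem wordsThrough_eq_empty {A : Finset (ℕ × ℕ)} (hA : ¬ LinForest A) (V : Finset ℕ) :
    wordsThrough V A = ∅ := by
  refine Finset.eq_empty_of_forall_notMem fun l hl => hA ?_
  obtain ⟨⟨hl, -⟩, h⟩ := mem_wordsThrough.1 hl
  exact ⟨l, hl, h⟩

/-! ### Arcs of short length -/

/-- The ordered pairs of distinct elements of `{0, …, n - 1}` at distance at most `d`. -/
def arcs (n d : ℕ) : Finset (ℕ × ℕ) :=
  (Finset.range n ×ˢ Finset.range n).filter fun e => e.1 ≠ e.2 ∧ e.1 ≤ e.2 + d ∧ e.2 ≤ e.1 + d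

theorem mem_arcs {n d : ℕ} {e : ℕ × ℕ} :
    e ∈ arcs n d ↔ (e.1 < n ∧ e.2 < n) ∧ e.1 ≠ e.2 ∧ e.1 ≤ e.2 + d ∧ e.2 ≤ e.1 + d := by
  simp [arcs]

open Classical in
/-- The linear forests with `k` arcs in `arcs n d`. -/
noncomputable def forests (n d k : ℕ) : Finset (Finset (ℕ × ℕ)) :=
  ((arcs n d).powersetCard k).filter LinForest

theorem mem_forests {n d k : ℕ} {A : Finset (ℕ × ℕ)} :
    A ∈ forests n d k ↔ (A ⊆ arcs n d ∧ A.card = k) ∧ LinForest A := by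
  simp [forests, Finset.mem_powersetCard]

theorem card_le_of_mem_forests {n d k : ℕ} {A : Finset (ℕ × ℕ)} (h : A ∈ forests n d k) :
    k ≤ n := by
  obtain ⟨⟨h1, h2⟩, h3⟩ := mem_forests.1 h
  have := (card_wordsThrough h3 (V := Finset.range n) fun e he => by
    have := mem_arcs.1 (h1 he); simp [this.1]).1
  simpa [h2] using this

theorem word_infix_iff {n : ℕ} (π : Equiv.Perm (Fin n)) (x y : ℕ) :
    [x, y] <:+: List.ofFn (fun i => (π i : ℕ)) ↔
      ∃ i j : Fin n, (j : ℕ) = i + 1 ∧ (π i : ℕ) = x ∧ (π j : ℕ) = y := by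
  rw [List.infix_iff_getElem?]
  constructor
  · rintro ⟨k, hk, h⟩
    simp only [List.length_cons, List.length_nil, List.length_ofFn] at hk
    have h0 := h 0 (by simp)
    have h1 := h 1 (by simp)
    simp only [List.getElem?_ofFn] at h0 h1
    rw [dif_pos (by omega)] at h0 h1
    refine ⟨⟨0 + k, by omega⟩, ⟨1 + k, by omega⟩, by simp; omega, by simpa using h0,
      by simpa using h1⟩
  · rintro ⟨i, j, hij, rfl, rfl⟩
    refine ⟨i, by simp; omega, ?_⟩
    intro k hk
    simp only [List.length_cons, List.length_nil] at hk
    interval_cases k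
    · simp
    · have : (⟨1 + (i : ℕ), by omega⟩ : Fin n) = j := Fin.ext (by simp; omega)
      simp [List.getElem?_ofFn, this]
      omega

theorem lt_minJump_iff {n d : ℕ} (hn : 2 ≤ n) (π : Equiv.Perm (Fin n)) :
    d + 1 ≤ minJump π ↔ ∀ e ∈ arcs n d, ¬ [e.1, e.2] <:+: List.ofFn (fun i => (π i : ℕ)) := by
  have hne : {k : ℕ | ∃ i j : Fin n, (j : ℕ) = (i : ℕ) + 1 ∧
      k = (((π j : ℕ) : ℤ) - ((π i : ℕ) : ℤ)).natAbs}.Nonempty :=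
    ⟨_, ⟨0, by omega⟩, ⟨1, by omega⟩, rfl, rfl⟩
  rw [minJump, le_csInf_iff (OrderBot.bddBelow _) hne]
  constructor
  · rintro h ⟨x, y⟩ he hi
    obtain ⟨i, j, hij, rfl, rfl⟩ := (word_infix_iff π x y).1 hi
    have := h _ ⟨i, j, hij, rfl⟩
    have := mem_arcs.1 he
    dsimp only at this
    omega
  · rintro h _ ⟨i, j, hij, rfl⟩
    by_contra hlt
    refine h (π i, π j) ?_ ((word_infix_iff π _ _).2 ⟨i, j, hij, rfl, rfl⟩)
    have : (π i : ℕ) ≠ π j := by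
      intro h
      have := π.injective (Fin.ext h)
      rw [this] at hij
      omega
    rw [mem_arcs]
    exact ⟨⟨(π i).2, (π j).2⟩, this, by dsimp only; omega, by dsimp only; omega⟩

theorem ofFn_mem_words {n : ℕ} (π : Equiv.Perm (Fin n)) :
    List.ofFn (fun i => (π i : ℕ)) ∈ words (Finset.range n) := by
  refine mem_words.2 ⟨List.nodup_ofFn.2 (Fin.val_injective.comp π.injective), ?_⟩
  ext x
  simp only [List.mem_toFinset, List.mem_ofFn, Finset.mem_range]
  constructor
  · rintro ⟨i, rfl⟩
    exact (π i).2
  · intro hx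
    exact ⟨π.symm ⟨x, hx⟩, by simp⟩

theorem image_ofFn_words (n : ℕ) :
    (Finset.univ : Finset (Equiv.Perm (Fin n))).image (fun π => List.ofFn (fun i => (π i : ℕ))) =
      words (Finset.range n) := by
  apply Finset.eq_of_subset_of_card_le
  · intro l hl
    obtain ⟨π, -, rfl⟩ := Finset.mem_image.1 hl
    exact ofFn_mem_words π
  · rw [Finset.card_image_of_injective, card_words, Finset.card_univ, Fintype.card_perm]
    · simp
    · intro π σ h
      ext i
      exact congrFun (List.ofFn_injective h) i

open Classical in
theorem card_filter_minJump {n : ℕ} (hn : 2 ≤ n) (d : ℕ) :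
    (Finset.univ.filter fun π : Equiv.Perm (Fin n) => d + 1 ≤ minJump π).card =
      ((words (Finset.range n)).filter fun l => ∀ e ∈ arcs n d, ¬ [e.1, e.2] <:+: l).card := by
  rw [← image_ofFn_words, Finset.filter_image, Finset.card_image_of_injective]
  · congr 1
    ext π
    simp [lt_minJump_iff hn]
  · intro π σ h
    ext i
    exact congrFun (List.ofFn_injective h) i

open Classical in
-- Inclusion–exclusion: for a fixed word, the alternating sum over subsets of the arcs of `E`
-- occurring in it is the indicator that none occurs.
theorem card_words_avoiding (V : Finset ℕ) (E : Finset (ℕ × ℕ)) :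
    (((words V).filter fun l => ∀ e ∈ E, ¬ [e.1, e.2] <:+: l).card : ℤ) =
      ∑ A ∈ E.powerset, (-1) ^ A.card * ((wordsThrough V A).card : ℤ) := by
  have h1 : ∀ l : List ℕ, (if ∀ e ∈ E, ¬ [e.1, e.2] <:+: l then (1 : ℤ) else 0) =
      ∑ A ∈ E.powerset, if ∀ e ∈ A, [e.1, e.2] <:+: l then (-1 : ℤ) ^ A.card else 0 := by
    intro l
    rw [← Finset.sum_filter]
    have : E.powerset.filter (fun A => ∀ e ∈ A, [e.1, e.2] <:+: l) =
        (E.filter fun e => [e.1, e.2] <:+: l).powerset := by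
      ext A
      simp only [Finset.mem_filter, Finset.mem_powerset, Finset.subset_iff]
      grind
    rw [this, Finset.sum_powerset_neg_one_pow_card]
    simp [Finset.filter_eq_empty_iff]
  rw [Finset.card_filter]
  push_cast
  rw [Finset.sum_congr rfl fun l _ => h1 l, Finset.sum_comm]
  refine Finset.sum_congr rfl fun A _ => ?_
  rw [wordsThrough, Finset.card_filter]
  push_cast
  rw [Finset.mul_sum]
  simp

theorem probMinJumpGe_eq {n : ℕ} (hn : 2 ≤ n) (d : ℕ) :
    probMinJumpGe n (d + 1) = ∑ k ∈ Finset.range (n + 1),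
      (-1 : ℝ) ^ k * (forests n d k).card / (n.descFactorial k : ℝ) := by
  classical
  have hZ := card_words_avoiding (Finset.range n) (arcs n d)
  have hR := congrArg (Int.cast : ℤ → ℝ) hZ
  push_cast at hR
  rw [probMinJumpGe, card_filter_minJump hn, hR, Fintype.card_perm, Fintype.card_fin]
  have hsub : ∀ A ∈ (arcs n d).powerset,
      (-1 : ℝ) ^ A.card * ((wordsThrough (Finset.range n) A).card : ℝ) =
      if LinForest A then (-1 : ℝ) ^ A.card * ((n - A.card).factorial : ℝ) else 0 := by
    intro A hA
    split_ifs with h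
    · rw [(card_wordsThrough h (V := Finset.range n) fun e he => by
        have := mem_arcs.1 (Finset.mem_powerset.1 hA he); simp [this.1]).2, Finset.card_range]
    · rw [wordsThrough_eq_empty h]
      simp
  rw [Finset.sum_congr rfl hsub, ← Finset.sum_filter, Finset.sum_div]
  rw [← Finset.sum_fiberwise_of_maps_to (g := Finset.card) (t := Finset.range (n + 1))]
  · refine Finset.sum_congr rfl fun k hk => ?_
    have : ((arcs n d).powerset.filter LinForest).filter (fun A => A.card = k) =
        forests n d k := by
      ext A
      simp only [Finset.mem_filter, Finset.mem_powerset, mem_forests]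
      tauto
    rw [this]
    have hkn : k ≤ n := by simpa [Nat.lt_succ_iff] using hk
    have hfac := Nat.factorial_mul_descFactorial hkn
    have hfac' : ((n - k).factorial : ℝ) * (n.descFactorial k : ℝ) = (n.factorial : ℝ) := by
      exact_mod_cast hfac
    have hd : (n.descFactorial k : ℝ) ≠ 0 := by
      have h : n.descFactorial k ≠ 0 := by
        rw [Ne, Nat.descFactorial_eq_zero_iff_lt]; omega
      exact_mod_cast h
    have hf : ((n - k).factorial : ℝ) ≠ 0 := by exact_mod_cast Nat.factorial_ne_zero _
    rw [Finset.sum_congr rfl (g := fun _ => (-1 : ℝ) ^ k / (n.descFactorial k : ℝ))]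
    · rw [Finset.sum_const, nsmul_eq_mul]
      ring
    · intro A hA
      rw [(mem_forests.1 hA).1.2, ← hfac']
      field_simp
  · intro A hA
    obtain ⟨h1, h2⟩ := Finset.mem_filter.1 hA
    have := card_le_of_mem_forests (mem_forests.2 ⟨⟨Finset.mem_powerset.1 h1, rfl⟩, h2⟩)
    exact Finset.mem_range.2 (by omega)

/-! ### Tuples of arcs -/

/-- Each set is the image of as many injective tuples as it has orderings. -/
theorem card_tuples_image {ι α : Type*} [Fintype ι] [DecidableEq ι] [DecidableEq α]
    (E : Finset α) (p : Finset α → Prop) [DecidablePred p] :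
    ((Fintype.piFinset fun _ : ι => E).filter fun e => Function.Injective e ∧
        p (Finset.univ.image e)).card =
      (Fintype.card ι).factorial * ((E.powersetCard (Fintype.card ι)).filter p).card := by
  rw [Finset.card_eq_sum_card_fiberwise (f := fun e => Finset.univ.image e)
    (t := (E.powersetCard (Fintype.card ι)).filter p)]
  · rw [Finset.sum_const_nat (m := (Fintype.card ι).factorial), mul_comm]
    intro A hA
    obtain ⟨hA, hp⟩ := Finset.mem_filter.1 hA
    obtain ⟨hAE, hAc⟩ := Finset.mem_powersetCard.1 hA
    have hc : Fintype.card ι = Fintype.card A := by simp [hAc]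
    rw [← Fintype.card_equiv (Fintype.equivOfCardEq hc), ← Finset.card_univ]
    symm
    refine Finset.card_bij (fun σ _ i => (σ i : α)) ?_ ?_ ?_
    · intro σ _
      have him : Finset.univ.image (fun i => (σ i : α)) = A := by
        ext x
        simp only [Finset.mem_image, Finset.mem_univ, true_and]
        constructor
        · rintro ⟨i, rfl⟩
          exact (σ i).2
        · intro hx
          exact ⟨σ.symm ⟨x, hx⟩, by simp⟩
      simp only [Finset.mem_filter, Fintype.mem_piFinset]
      refine ⟨⟨fun i => hAE (σ i).2, Subtype.val_injective.comp σ.injective, ?_⟩, him⟩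
      rw [him]
      exact hp
    · intro σ _ τ _ h
      ext i
      exact congrFun h i
    · intro e he
      simp only [Finset.mem_filter, Fintype.mem_piFinset] at he
      obtain ⟨⟨-, hinj, -⟩, rfl⟩ := he
      refine ⟨Equiv.ofBijective (fun i => ⟨e i, Finset.mem_image_of_mem _ (Finset.mem_univ i)⟩)
        ⟨fun i j h => hinj (by simpa using h), ?_⟩, Finset.mem_univ _, rfl⟩
      rintro ⟨x, hx⟩
      obtain ⟨i, -, rfl⟩ := Finset.mem_image.1 hx
      exact ⟨i, rfl⟩
  · intro e he
    simp only [Finset.coe_filter, Fintype.mem_piFinset, Set.mem_ofPred_eq] at he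
    simp only [Finset.coe_filter, Finset.mem_powersetCard, Set.mem_ofPred_eq]
    refine ⟨⟨?_, ?_⟩, he.2.2⟩
    · intro x hx
      obtain ⟨i, -, rfl⟩ := Finset.mem_image.1 hx
      exact he.1 i
    · rw [Finset.card_image_of_injective _ he.2.1, Finset.card_univ]

/-- The coordinates outside `B` are unconstrained, and those in `B` enumerate a set satisfying `p`.
-/
theorem card_tuples_injOn {ι α : Type*} [Fintype ι] [DecidableEq ι] [DecidableEq α]
    (E : Finset α) (p : Finset α → Prop) [DecidablePred p] (B : Finset ι) :
    (((Fintype.piFinset fun _ : ι => E).filter fun e => Set.InjOn e B ∧ p (B.image e)).card) =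
      E.card ^ (Fintype.card ι - B.card) *
        (B.card.factorial * ((E.powersetCard B.card).filter p).card) := by
  have h := card_tuples_image (ι := B) E p
  rw [Fintype.card_coe] at h
  rw [← h]
  have h2 : (Fintype.piFinset fun _ : {i // i ∉ B} => E).card =
      E.card ^ (Fintype.card ι - B.card) := by
    rw [Fintype.card_piFinset, Finset.prod_const, Finset.card_univ, Fintype.card_subtype_compl]
    simp
  rw [← h2, mul_comm, ← Finset.card_product]
  refine Finset.card_equiv (Equiv.piEquivPiSubtypeProd (fun i => i ∈ B) fun _ => α) ?_
  intro e
  have him : (Finset.univ.image fun i : B => e i) = B.image e := by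
    ext x
    simp
  have hinj : (Function.Injective fun i : B => e i) ↔ Set.InjOn e B :=
    Set.injOn_iff_injective.symm
  simp only [Finset.mem_filter, Fintype.mem_piFinset, Finset.mem_product,
    Equiv.piEquivPiSubtypeProd_apply]
  rw [him, hinj]
  constructor
  · rintro ⟨h1, h2⟩
    exact ⟨⟨fun i => h1 i, h2⟩, fun i => h1 i⟩
  · rintro ⟨⟨h1, h2⟩, h3⟩
    refine ⟨fun i => ?_, h2⟩
    by_cases hi : i ∈ B
    · exact h1 ⟨i, hi⟩
    · exact h3 ⟨i, hi⟩

/-- The binomial transform of `a ↦ a ! * (forests n d a).card`, centred at the number of arcs. -/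
noncomputable def centredCount (n d b : ℕ) : ℝ :=
  ∑ a ∈ Finset.range (b + 1), (b.choose a : ℝ) * (-((arcs n d).card : ℝ)) ^ (b - a) *
    (a.factorial * (forests n d a).card)

theorem binomial_inversion (x : ℕ → ℝ) (m : ℝ) (k : ℕ) :
    x k = ∑ b ∈ Finset.range (k + 1), (k.choose b : ℝ) * m ^ (k - b) *
      ∑ a ∈ Finset.range (b + 1), (b.choose a : ℝ) * (-m) ^ (b - a) * x a := by
  -- Umbral argument: `L` sends `X ^ a` to `x a`, and the identity is `L` applied to the expansion
  -- of `((X - m) + m) ^ k`.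
  let L : Polynomial ℝ →ₗ[ℝ] ℝ := Polynomial.lsum fun a => x a • LinearMap.id
  have hL : ∀ (a : ℕ) (c : ℝ), L (Polynomial.X ^ a * Polynomial.C c) = c * x a := by
    intro a c
    rw [mul_comm, Polynomial.C_mul_X_pow_eq_monomial]
    simp [L, Polynomial.lsum_apply, Polynomial.sum_monomial_index, mul_comm]
  have hG : ∀ b : ℕ, L ((Polynomial.X + Polynomial.C (-m)) ^ b) =
      ∑ a ∈ Finset.range (b + 1), (b.choose a : ℝ) * (-m) ^ (b - a) * x a := by
    intro b
    rw [add_pow, map_sum]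
    refine Finset.sum_congr rfl fun a _ => ?_
    rw [← Polynomial.C_pow, ← Polynomial.C_eq_natCast, mul_assoc, ← Polynomial.C_mul, hL]
    ring
  have hk : x k = L ((Polynomial.X + Polynomial.C (-m) + Polynomial.C m) ^ k) := by
    have : (Polynomial.X + Polynomial.C (-m) + Polynomial.C m : Polynomial ℝ) = Polynomial.X := by
      simp
    rw [this]
    have := hL k 1
    simp only [Polynomial.C_1, mul_one, one_mul] at this
    exact this.symm
  rw [hk, add_pow, map_sum]
  refine Finset.sum_congr rfl fun b _ => ?_
  rw [← Polynomial.C_pow, ← Polynomial.C_eq_natCast, mul_assoc, ← Polynomial.C_mul, mul_comm,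
    ← Polynomial.smul_eq_C_mul, map_smul, hG, smul_eq_mul]
  ring

theorem factorial_mul_card_forests (n d k : ℕ) :
    (k.factorial : ℝ) * (forests n d k).card =
      ∑ b ∈ Finset.range (k + 1), (k.choose b : ℝ) * ((arcs n d).card : ℝ) ^ (k - b) *
        centredCount n d b :=
  binomial_inversion (fun k => (k.factorial : ℝ) * (forests n d k).card) _ k

/-! ### Cancellation for tuples with an isolated arc -/

/-- Two arcs touch if they share an endpoint. -/
def Touch (e f : ℕ × ℕ) : Prop := e.1 = f.1 ∨ e.1 = f.2 ∨ e.2 = f.1 ∨ e.2 = f.2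

instance : DecidableRel Touch := fun e f => by unfold Touch; infer_instance

theorem Touch.symm {e f : ℕ × ℕ} (h : Touch e f) : Touch f e := by
  unfold Touch at *
  tauto

/-- Delete the endpoints of `e` from the word and append `e` at the end: arcs not touching `e` stay
consecutive. -/
theorem linForest_insert {A : Finset (ℕ × ℕ)} {e : ℕ × ℕ} (he : e.1 ≠ e.2)
    (h : ∀ f ∈ A, ¬ Touch e f) : LinForest (insert e A) ↔ LinForest A := by
  refine ⟨LinForest.mono (Finset.subset_insert _ _), ?_⟩
  rintro ⟨l, hl, hA⟩
  refine ⟨l.filter (fun x => x ≠ e.1 ∧ x ≠ e.2) ++ [e.1, e.2], ?_, ?_⟩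
  · rw [List.nodup_append]
    refine ⟨hl.filter _, by simpa using he, ?_⟩
    intro a ha b hb
    simp at ha hb
    rcases hb with rfl | rfl
    · exact ha.2.1
    · exact ha.2.2
  · intro f hf
    rcases Finset.mem_insert.1 hf with rfl | hf
    · exact (List.suffix_append _ _).isInfix
    · have h1 := (hA f hf).filter (fun x => decide (x ≠ e.1 ∧ x ≠ e.2))
      have h2 := h f hf
      simp only [Touch, not_or] at h2
      have h3 : [f.1, f.2].filter (fun x => decide (x ≠ e.1 ∧ x ≠ e.2)) = [f.1, f.2] := by
        rw [List.filter_eq_self]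
        intro x hx
        simp only [List.mem_cons, List.not_mem_nil, or_false] at hx
        rcases hx with rfl | rfl
        · simpa using ⟨fun h => h2.1 h.symm, fun h => h2.2.2.1 h.symm⟩
        · simpa using ⟨fun h => h2.2.1 h.symm, fun h => h2.2.2.2 h.symm⟩
      rw [h3] at h1
      exact h1.trans (List.prefix_append _ _).isInfix

open Classical in
/-- The alternating sum over subtuples of the indicator of being a linear forest. -/
noncomputable def tupleWeight {b : ℕ} (e : Fin b → ℕ × ℕ) : ℝ :=
  ∑ B ∈ (Finset.univ : Finset (Fin b)).powerset, (-1) ^ (b - B.card) *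
    if Set.InjOn e B ∧ LinForest (B.image e) then 1 else 0

theorem abs_tupleWeight_le {b : ℕ} (e : Fin b → ℕ × ℕ) : |tupleWeight e| ≤ 2 ^ b := by
  refine (Finset.abs_sum_le_sum_abs _ _).trans ?_
  refine (Finset.sum_le_card_nsmul _ _ 1 ?_).trans ?_
  · intro B _
    rw [abs_mul, abs_pow, abs_neg, abs_one, one_pow, one_mul]
    split_ifs <;> simp
  · simp

/-- After exchanging the sums, the number of tuples whose restriction to `B` enumerates a forest
depends only on the size of `B`. -/
theorem centredCount_eq_sum (n d b : ℕ) :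
    centredCount n d b =
      ∑ e ∈ Fintype.piFinset fun _ : Fin b => arcs n d, tupleWeight e := by
  classical
  unfold tupleWeight
  rw [Finset.sum_comm]
  have h : ∀ B ∈ (Finset.univ : Finset (Fin b)).powerset,
      (∑ e ∈ Fintype.piFinset fun _ : Fin b => arcs n d, (-1 : ℝ) ^ (b - B.card) *
        if Set.InjOn e B ∧ LinForest (B.image e) then 1 else 0) =
      (fun a => (-((arcs n d).card : ℝ)) ^ (b - a) * (a.factorial * (forests n d a).card))
        B.card := by
    intro B _
    have := card_tuples_injOn (arcs n d) LinForest B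
    rw [← Finset.mul_sum, ← Finset.sum_filter, Finset.sum_const, nsmul_eq_mul, mul_one, this,
      Fintype.card_fin, neg_pow]
    push_cast
    unfold forests
    ring
  rw [Finset.sum_congr rfl h, Finset.sum_powerset_apply_card (fun a =>
    (-((arcs n d).card : ℝ)) ^ (b - a) * ((a.factorial : ℝ) * ((forests n d a).card : ℝ)))]
  simp only [Finset.card_univ, Fintype.card_fin, nsmul_eq_mul, centredCount]
  refine Finset.sum_congr rfl fun a _ => ?_
  ring

/-- Adding or removing an isolated index `i` leaves the forest condition on `B` unchanged and flips
the sign, so the terms cancel in pairs. -/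
theorem tupleWeight_eq_zero {b : ℕ} {e : Fin b → ℕ × ℕ} (he : ∀ i, (e i).1 ≠ (e i).2) {i : Fin b}
    (h : ∀ j, j ≠ i → ¬ Touch (e i) (e j)) : tupleWeight e = 0 := by
  classical
  unfold tupleWeight
  rw [← Finset.insert_erase (Finset.mem_univ i), Finset.sum_powerset_insert (by simp),
    ← Finset.sum_add_distrib]
  refine Finset.sum_eq_zero fun B hB => ?_
  have hi : i ∉ B := fun hi => by simpa using Finset.mem_powerset.1 hB hi
  have hnt : ∀ f ∈ B.image e, ¬ Touch (e i) f := by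
    intro f hf
    obtain ⟨j, hj, rfl⟩ := Finset.mem_image.1 hf
    exact h j fun hji => hi (hji ▸ hj)
  have hnot : e i ∉ e '' B := by
    rintro ⟨j, hj, hji⟩
    exact hnt (e j) (Finset.mem_image_of_mem _ hj) (by rw [hji]; exact Or.inl rfl)
  have hcard : B.card + 1 ≤ b := by
    have := Finset.card_le_card (Finset.mem_powerset.1 hB)
    rw [Finset.card_erase_of_mem (Finset.mem_univ i), Finset.card_univ, Fintype.card_fin] at this
    have := i.2
    omega
  have hiff : (Set.InjOn e (insert i B : Finset (Fin b)) ∧ LinForest ((insert i B).image e)) ↔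
      Set.InjOn e B ∧ LinForest (B.image e) := by
    rw [Finset.image_insert, linForest_insert (he i) hnt, Finset.coe_insert, Set.injOn_insert
      (by simpa using hi)]
    tauto
  rw [Finset.card_insert_of_notMem hi]
  have : b - B.card = b - (B.card + 1) + 1 := by omega
  rw [this, pow_succ]
  by_cases hB : Set.InjOn e B ∧ LinForest (B.image e)
  · rw [if_pos hB, if_pos (hiff.2 hB)]
    ring
  · rw [if_neg hB, if_neg fun h => hB (hiff.1 h)]
    ring

/-- In a graph without isolated vertices some dominating set contains at most half of the
vertices. -/
theorem exists_dominating {ι : Type*} [Fintype ι] [DecidableEq ι] {r : ι → ι → Prop}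
    (hsymm : ∀ i j, r i j → r j i) (h : ∀ i, ∃ j, j ≠ i ∧ r i j) :
    ∃ R : Finset ι, 2 * R.card ≤ Fintype.card ι ∧ ∀ i ∉ R, ∃ j ∈ R, r i j := by
  classical
  obtain ⟨D, hD, hmin⟩ := (Finset.univ.filter fun R : Finset ι => ∀ i ∉ R, ∃ j ∈ R, r i j)
    |>.exists_min_image Finset.card ⟨Finset.univ, by simp⟩
  simp only [Finset.mem_filter, Finset.mem_univ, true_and] at hD hmin
  by_cases hc : 2 * D.card ≤ Fintype.card ι
  · exact ⟨D, hc, hD⟩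
  -- The complement of a minimum dominating set also dominates: a vertex of `D` with no neighbour in
  -- the complement has a neighbour in `D`, so it could be dropped from `D`.
  refine ⟨Dᶜ, by rw [Finset.card_compl]; omega, ?_⟩
  intro i hi
  simp only [Finset.mem_compl, not_not] at hi
  by_contra hno
  push Not at hno
  have := hmin (D.erase i) ?_
  · have := Finset.card_erase_lt_of_mem hi
    omega
  intro x hx
  obtain ⟨j, hji, hij⟩ := h i
  by_cases hxi : x = i
  · subst hxi
    refine ⟨j, Finset.mem_erase.2 ⟨hji, ?_⟩, hij⟩
    by_contra hj
    exact hno j (by simpa using hj) hij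
  · have hxD : x ∉ D := fun h => hx (Finset.mem_erase.2 ⟨hxi, h⟩)
    obtain ⟨y, hy, hxy⟩ := hD x hxD
    refine ⟨y, Finset.mem_erase.2 ⟨?_, hy⟩, hxy⟩
    rintro rfl
    exact hno x (by simpa using hxD) (hsymm _ _ hxy)

/-! ### Counting arcs and tuples without isolated arcs -/

/-- There are four ways to share an endpoint, each leaving at most `2d + 1` values for the other
one. -/
theorem card_touching_le (n d : ℕ) (e : ℕ × ℕ) :
    ((arcs n d).filter fun f => Touch f e).card ≤ 8 * (d + 1) := by
  have hsub : ((arcs n d).filter fun f => Touch f e) ⊆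
      ((Finset.Icc (e.1 - d) (e.1 + d)).image (fun x => (e.1, x)) ∪
        (Finset.Icc (e.2 - d) (e.2 + d)).image (fun x => (e.2, x))) ∪
      ((Finset.Icc (e.1 - d) (e.1 + d)).image (fun x => (x, e.1)) ∪
        (Finset.Icc (e.2 - d) (e.2 + d)).image (fun x => (x, e.2))) := by
    rintro ⟨x, y⟩ hf
    obtain ⟨hf, ht⟩ := Finset.mem_filter.1 hf
    have := mem_arcs.1 hf
    simp only [Touch] at ht
    simp only [Finset.mem_union, Finset.mem_image, Finset.mem_Icc, Prod.mk.injEq]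
    dsimp only at this
    rcases ht with h | h | h | h
    · exact Or.inl (Or.inl ⟨y, by omega, by omega, rfl⟩)
    · exact Or.inl (Or.inr ⟨y, by omega, by omega, rfl⟩)
    · exact Or.inr (Or.inl ⟨x, by omega, rfl, by omega⟩)
    · exact Or.inr (Or.inr ⟨x, by omega, rfl, by omega⟩)
  have hI : ∀ v, (Finset.Icc (v - d) (v + d)).card ≤ 2 * d + 1 := by
    intro v
    rw [Nat.card_Icc]
    omega
  refine (Finset.card_le_card hsub).trans ?_
  refine (Finset.card_union_le _ _).trans ?_
  have h1 := Finset.card_union_le ((Finset.Icc (e.1 - d) (e.1 + d)).image (fun x => (e.1, x)))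
    ((Finset.Icc (e.2 - d) (e.2 + d)).image (fun x => (e.2, x)))
  have h2 := Finset.card_union_le ((Finset.Icc (e.1 - d) (e.1 + d)).image (fun x => (x, e.1)))
    ((Finset.Icc (e.2 - d) (e.2 + d)).image (fun x => (x, e.2)))
  have g1 := (Finset.card_image_le (s := Finset.Icc (e.1 - d) (e.1 + d))
    (f := fun x => (e.1, x))).trans (hI _)
  have g2 := (Finset.card_image_le (s := Finset.Icc (e.2 - d) (e.2 + d))
    (f := fun x => (e.2, x))).trans (hI _)
  have g3 := (Finset.card_image_le (s := Finset.Icc (e.1 - d) (e.1 + d))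
    (f := fun x => (x, e.1))).trans (hI _)
  have g4 := (Finset.card_image_le (s := Finset.Icc (e.2 - d) (e.2 + d))
    (f := fun x => (x, e.2))).trans (hI _)
  omega

theorem card_arcs_succ_le (n d : ℕ) : (arcs (n + 1) d).card ≤ (arcs n d).card + 2 * d := by
  have hsub : arcs (n + 1) d ⊆ arcs n d ∪ ((Finset.Ico (n - d) n).image (fun x => (x, n)) ∪
      (Finset.Ico (n - d) n).image (fun x => (n, x))) := by
    rintro ⟨x, y⟩ h
    have := mem_arcs.1 h
    simp only [Finset.mem_union, mem_arcs, Finset.mem_image, Finset.mem_Ico, Prod.mk.injEq]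
    dsimp only at this
    by_cases hx : x = n
    · exact Or.inr (Or.inr ⟨y, by omega, hx.symm, rfl⟩)
    · by_cases hy : y = n
      · exact Or.inr (Or.inl ⟨x, by omega, rfl, hy.symm⟩)
      · exact Or.inl (by omega)
  have hI : (Finset.Ico (n - d) n).card ≤ d := by
    rw [Nat.card_Ico]
    omega
  have h1 := Finset.card_union_le ((Finset.Ico (n - d) n).image (fun x => (x, n)))
    ((Finset.Ico (n - d) n).image (fun x => (n, x)))
  have g1 := (Finset.card_image_le (s := Finset.Ico (n - d) n) (f := fun x => (x, n))).trans hI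
  have g2 := (Finset.card_image_le (s := Finset.Ico (n - d) n) (f := fun x => (n, x))).trans hI
  have := (Finset.card_le_card hsub).trans (Finset.card_union_le _ _)
  omega

theorem card_arcs_le (n d : ℕ) : (arcs n d).card ≤ 2 * d * n := by
  induction n with
  | zero => simp [arcs]
  | succ n ih =>
    have := card_arcs_succ_le n d
    rw [mul_add]
    omega

theorem card_arcs_succ {n d : ℕ} (h : d ≤ n) :
    (arcs (n + 1) d).card = (arcs n d).card + 2 * d := by
  refine le_antisymm (card_arcs_succ_le n d) ?_
  have hd1 : Disjoint ((Finset.Ico (n - d) n).image (fun x => (x, n)))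
      ((Finset.Ico (n - d) n).image (fun x => (n, x))) := by
    rw [Finset.disjoint_left]
    intro e h1 h2
    simp only [Finset.mem_image, Finset.mem_Ico] at h1 h2
    obtain ⟨x, hx, rfl⟩ := h1
    obtain ⟨y, hy, h⟩ := h2
    simp only [Prod.mk.injEq] at h
    omega
  have hd2 : Disjoint (arcs n d) ((Finset.Ico (n - d) n).image (fun x => (x, n)) ∪
      (Finset.Ico (n - d) n).image (fun x => (n, x))) := by
    rw [Finset.disjoint_left]
    intro e h1 h2
    have := mem_arcs.1 h1
    simp only [Finset.mem_union, Finset.mem_image, Finset.mem_Ico] at h2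
    rcases h2 with ⟨x, hx, rfl⟩ | ⟨x, hx, rfl⟩
    · dsimp only at this; omega
    · dsimp only at this; omega
  have hsub : arcs n d ∪ ((Finset.Ico (n - d) n).image (fun x => (x, n)) ∪
      (Finset.Ico (n - d) n).image (fun x => (n, x))) ⊆ arcs (n + 1) d := by
    intro e he
    simp only [Finset.mem_union, Finset.mem_image, Finset.mem_Ico, mem_arcs] at he
    rw [mem_arcs]
    rcases he with h | ⟨x, hx, rfl⟩ | ⟨x, hx, rfl⟩
    · omega
    · dsimp only; omega
    · dsimp only; omega
  have := Finset.card_le_card hsub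
  rw [Finset.card_union_of_disjoint hd2, Finset.card_union_of_disjoint hd1,
    Finset.card_image_of_injective _ (fun x y h => by simpa using h),
    Finset.card_image_of_injective _ (fun x y h => by simpa using h), Nat.card_Ico] at this
  omega

/-- At `n = d` all ordered pairs are arcs, and each further point adds `2d`. -/
theorem card_arcs_eq {n d : ℕ} (h : d ≤ n) :
    ((arcs n d).card : ℝ) = 2 * d * n - d * (d + 1) := by
  induction n, h using Nat.le_induction with
  | base =>
    have : arcs d d = (Finset.range d).offDiag := by
      ext e
      rw [mem_arcs, Finset.mem_offDiag, Finset.mem_range, Finset.mem_range]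
      omega
    rw [this, Finset.offDiag_card, Finset.card_range, Nat.cast_sub (Nat.le_mul_self d)]
    push_cast
    ring
  | succ n hn ih =>
    rw [card_arcs_succ hn]
    push_cast
    rw [ih]
    ring

theorem card_tuples_dominated {b : ℕ} (n d : ℕ) (R : Finset (Fin b)) :
    ((Fintype.piFinset fun _ : Fin b => arcs n d).filter
      fun e => ∀ i ∉ R, ∃ j ∈ R, Touch (e i) (e j)).card ≤
      (arcs n d).card ^ R.card * (b * (8 * (d + 1))) ^ (b - R.card) := by
  classical
  -- `Z` records the coordinates in `R`, with a dummy value elsewhere; `S z` lists the tuples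
  -- extending the record `z`, whose other arcs each touch one of at most `b` recorded arcs.
  let Z : Finset (Fin b → ℕ × ℕ) :=
    Fintype.piFinset fun i : Fin b => if i ∈ R then arcs n d else {(0, 0)}
  let S : (Fin b → ℕ × ℕ) → Finset (Fin b → ℕ × ℕ) := fun z =>
    Fintype.piFinset fun i : Fin b => if i ∈ R then {z i} else
      R.biUnion fun j => (arcs n d).filter fun f => Touch f (z j)
  have hsub : ((Fintype.piFinset fun _ : Fin b => arcs n d).filter
      fun e => ∀ i ∉ R, ∃ j ∈ R, Touch (e i) (e j)) ⊆ Z.biUnion S := by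
    intro e he
    simp only [Finset.mem_filter, Fintype.mem_piFinset] at he
    rw [Finset.mem_biUnion]
    refine ⟨fun i => if i ∈ R then e i else (0, 0), ?_, ?_⟩
    · rw [Fintype.mem_piFinset]
      intro i
      by_cases hi : i ∈ R
      · simpa [hi] using he.1 i
      · simp [hi]
    · rw [Fintype.mem_piFinset]
      intro i
      by_cases hi : i ∈ R
      · simp [hi]
      · rw [if_neg hi, Finset.mem_biUnion]
        obtain ⟨j, hj, ht⟩ := he.2 i hi
        exact ⟨j, hj, Finset.mem_filter.2 ⟨he.1 i, by simpa [hj] using ht⟩⟩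
  have hZ : Z.card = (arcs n d).card ^ R.card := by
    rw [Fintype.card_piFinset]
    simp only [apply_ite Finset.card, Finset.card_singleton]
    rw [Finset.prod_ite]
    simp
  have hS : ∀ z, (S z).card ≤ (b * (8 * (d + 1))) ^ (b - R.card) := by
    intro z
    rw [Fintype.card_piFinset]
    simp only [apply_ite Finset.card, Finset.card_singleton]
    rw [Finset.prod_ite, Finset.prod_const_one, one_mul]
    refine (Finset.prod_le_pow_card _ _ (b * (8 * (d + 1))) ?_).trans ?_
    · intro i _
      refine (Finset.card_biUnion_le_card_mul _ _ (8 * (d + 1)) fun j _ =>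
        card_touching_le n d _).trans ?_
      refine Nat.mul_le_mul_right _ ?_
      simpa using Finset.card_le_univ R
    · have : (Finset.univ.filter fun i => i ∉ R) = Rᶜ := by
        ext i
        simp
      rw [this, Finset.card_compl, Fintype.card_fin]
  refine (Finset.card_le_card hsub).trans ?_
  refine (Finset.card_biUnion_le_card_mul _ _ _ fun z _ => hS z).trans ?_
  rw [hZ]

/-- Only tuples without an isolated arc contribute, and these are dominated by at most `b / 2` of
their arcs. The constant is `32 = 2 · 2 · 8`: the choice of the dominating set, the bound on the
weight, and the count of touching arcs. -/
theorem abs_centredCount_le (n d b : ℕ) :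
    |centredCount n d b| ≤ ((32 * b * (d + 1) : ℝ)) ^ b * (n : ℝ) ^ (b / 2) := by
  classical
  rcases Nat.eq_zero_or_pos n with rfl | hn
  · rw [centredCount_eq_sum]
    rcases Nat.eq_zero_or_pos b with rfl | hb
    · refine (Finset.abs_sum_le_sum_abs _ _).trans ?_
      refine (Finset.sum_le_sum fun e _ => abs_tupleWeight_le e).trans ?_
      simp
    · have : (Fintype.piFinset fun _ : Fin b => arcs 0 d) = ∅ := by
        refine Finset.eq_empty_of_forall_notMem fun e he => ?_
        have := Fintype.mem_piFinset.1 he ⟨0, hb⟩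
        simp [arcs] at this
      rw [this]
      simp only [Finset.sum_empty, abs_zero]
      positivity
  let T : Finset (Fin b → ℕ × ℕ) := (Fintype.piFinset fun _ : Fin b => arcs n d).filter
    fun e => ∀ i, ∃ j, j ≠ i ∧ Touch (e i) (e j)
  have h1 : centredCount n d b = ∑ e ∈ T, tupleWeight e := by
    rw [centredCount_eq_sum]
    symm
    refine Finset.sum_subset (Finset.filter_subset _ _) fun e he hne => ?_
    have : ¬ ∀ i, ∃ j, j ≠ i ∧ Touch (e i) (e j) := fun h => hne (Finset.mem_filter.2 ⟨he, h⟩)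
    push Not at this
    obtain ⟨i, hi⟩ := this
    exact tupleWeight_eq_zero (fun i => (mem_arcs.1 (Fintype.mem_piFinset.1 he i)).2.1) hi
  have hT : T.card ≤ 2 ^ b * ((8 * b * (d + 1)) ^ b * n ^ (b / 2)) := by
    have hsub : T ⊆ ((Finset.univ : Finset (Finset (Fin b))).filter
        fun R => 2 * R.card ≤ b).biUnion fun R =>
        (Fintype.piFinset fun _ : Fin b => arcs n d).filter
          fun e => ∀ i ∉ R, ∃ j ∈ R, Touch (e i) (e j) := by
      intro e he
      obtain ⟨he, h⟩ := Finset.mem_filter.1 he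
      obtain ⟨R, hR, hdom⟩ := exists_dominating (r := fun i j => Touch (e i) (e j))
        (fun i j h => h.symm) h
      rw [Fintype.card_fin] at hR
      exact Finset.mem_biUnion.2 ⟨R, by simpa using hR, Finset.mem_filter.2 ⟨he, hdom⟩⟩
    refine (Finset.card_le_card hsub).trans ?_
    refine (Finset.card_biUnion_le_card_mul _ _ ((8 * b * (d + 1)) ^ b * n ^ (b / 2)) ?_).trans ?_
    · intro R hR
      have hR : 2 * R.card ≤ b := by simpa using hR
      refine (card_tuples_dominated n d R).trans ?_
      have hle : R.card ≤ b := by omega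
      calc (arcs n d).card ^ R.card * (b * (8 * (d + 1))) ^ (b - R.card)
          ≤ (8 * b * (d + 1) * n) ^ R.card * (8 * b * (d + 1)) ^ (b - R.card) := by
            refine Nat.mul_le_mul ?_ (le_of_eq (by ring))
            rcases Nat.eq_zero_or_pos b with rfl | hb
            · have : R.card = 0 := by omega
              simp [this]
            · refine Nat.pow_le_pow_left ((card_arcs_le n d).trans ?_) _
              refine Nat.mul_le_mul_right _ ?_
              nlinarith
        _ = (8 * b * (d + 1)) ^ b * n ^ R.card := by
            rw [mul_pow, mul_right_comm, ← pow_add, Nat.add_sub_cancel' hle]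
        _ ≤ _ := Nat.mul_le_mul_left _ (Nat.pow_le_pow_right hn (by omega))
    · refine Nat.mul_le_mul_right _ ((Finset.card_filter_le _ _).trans ?_)
      simp
  rw [h1]
  refine (Finset.abs_sum_le_sum_abs _ _).trans ?_
  refine (Finset.sum_le_card_nsmul _ _ _ fun e _ => abs_tupleWeight_le e).trans ?_
  rw [nsmul_eq_mul]
  have hT' : (T.card : ℝ) ≤ 2 ^ b * ((8 * b * (d + 1)) ^ b * n ^ (b / 2)) := by exact_mod_cast hT
  calc (T.card : ℝ) * 2 ^ b ≤ 2 ^ b * ((8 * b * (d + 1)) ^ b * n ^ (b / 2)) * 2 ^ b := by gcongr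
    _ = (2 * 2 * (8 * b * (d + 1))) ^ b * n ^ (b / 2) := by
      simp only [mul_pow]
      ring
    _ = _ := by ring

/-! ### Polynomiality of the forest counts -/

/-- No arc of `A` crosses the gap below `c`. -/
def IsCut (A : Finset (ℕ × ℕ)) (c : ℕ) : Prop :=
  ∀ e ∈ A, (e.1 < c ∧ e.2 < c) ∨ (c ≤ e.1 ∧ c ≤ e.2)

open Classical in
/-- The linear forests on `{0, …, n - 1}` crossing every inner gap. -/
noncomputable def irredForests (n d k : ℕ) : Finset (Finset (ℕ × ℕ)) :=
  (forests n d k).filter fun A => ∀ c, 0 < c → c < n → ¬ IsCut A c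

theorem mem_irredForests {n d k : ℕ} {A : Finset (ℕ × ℕ)} :
    A ∈ irredForests n d k ↔ A ∈ forests n d k ∧ ∀ c, 0 < c → c < n → ¬ IsCut A c := by
  simp [irredForests]

/-- Translation of arcs to the right. -/
def shiftArc (c : ℕ) (e : ℕ × ℕ) : ℕ × ℕ := (e.1 + c, e.2 + c)

/-- Translation of arcs to the left. -/
def unshiftArc (c : ℕ) (e : ℕ × ℕ) : ℕ × ℕ := (e.1 - c, e.2 - c)

theorem shiftArc_injective (c : ℕ) : Function.Injective (shiftArc c) := by
  rintro ⟨x, y⟩ ⟨x', y'⟩ h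
  simpa [shiftArc] using h

theorem unshift_shiftArc (c : ℕ) (e : ℕ × ℕ) : unshiftArc c (shiftArc c e) = e := by
  simp [shiftArc, unshiftArc]

theorem shift_unshiftArc {c : ℕ} {e : ℕ × ℕ} (h1 : c ≤ e.1) (h2 : c ≤ e.2) :
    shiftArc c (unshiftArc c e) = e := by
  simp [shiftArc, unshiftArc, h1, h2]

theorem LinForest.unshift {A : Finset (ℕ × ℕ)} (hA : LinForest A) {c : ℕ}
    (h : ∀ e ∈ A, c ≤ e.1 ∧ c ≤ e.2) : LinForest (A.image (unshiftArc c)) := by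
  obtain ⟨l, hl, hA⟩ := hA
  refine ⟨(l.filter fun x => c ≤ x).map (· - c), ?_, ?_⟩
  · refine (hl.filter _).map_on ?_
    intro x hx y hy hxy
    simp at hx hy
    omega
  · intro e' he'
    obtain ⟨e, he, rfl⟩ := Finset.mem_image.1 he'
    have := ((hA e he).filter fun x => decide (c ≤ x)).map (· - c)
    simpa [List.filter_cons, h e he, unshiftArc] using this

theorem LinForest.union_shift {A B : Finset (ℕ × ℕ)} (hA : LinForest A) (hB : LinForest B) {c : ℕ}
    (h : ∀ e ∈ A, e.1 < c ∧ e.2 < c) : LinForest (A ∪ B.image (shiftArc c)) := by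
  obtain ⟨l, hl, hA⟩ := hA
  obtain ⟨l', hl', hB⟩ := hB
  refine ⟨(l.filter fun x => x < c) ++ l'.map (· + c), ?_, ?_⟩
  · refine List.nodup_append.2 ⟨hl.filter _, hl'.map (add_left_injective c), ?_⟩
    intro x hx y hy
    simp at hx hy
    omega
  · intro e' he'
    rcases Finset.mem_union.1 he' with he | he
    · have := (hA e' he).filter fun x => decide (x < c)
      simp only [List.filter_cons, h e' he, decide_true, if_true, List.filter_nil] at this
      exact this.trans (List.prefix_append _ _).isInfix
    · obtain ⟨e, heB, rfl⟩ := Finset.mem_image.1 he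
      have := (hB e heB).map (· + c)
      exact this.trans (List.suffix_append _ _).isInfix

theorem isCut_zero (A : Finset (ℕ × ℕ)) : IsCut A 0 := fun e _ => Or.inr ⟨e.1.zero_le, e.2.zero_le⟩

open Classical in
/-- The forests whose last cut is at `c`, with `i` arcs below and `j` arcs above the cut. -/
theorem card_forests_lastCut (n d c i j : ℕ) (hc : c ≤ n) :
    ((forests (n + 1) d (i + j)).filter fun A => Nat.findGreatest (IsCut A) n = c ∧
        (A.filter fun e => e.1 < c).card = i).card =
      (forests c d i).card * (irredForests (n + 1 - c) d j).card := by
  rw [← Finset.card_product]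
  refine Finset.card_nbij'
    (fun A => (A.filter fun e => e.1 < c, (A.filter fun e => c ≤ e.1).image (unshiftArc c)))
    (fun p => p.1 ∪ p.2.image (shiftArc c)) ?_ ?_ ?_ ?_
  · intro A hA
    obtain ⟨hA, hcut, hi⟩ := Finset.mem_filter.1 hA
    obtain ⟨⟨hAE, hAc⟩, hlin⟩ := mem_forests.1 hA
    obtain ⟨-, hcut, hmax⟩ := Nat.findGreatest_eq_iff.1 hcut
    -- `Nat.findGreatest` returns `0` by default, which does no harm since the gap below `0` is
    -- always a cut.
    have hcut : IsCut A c := by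
      rcases Nat.eq_zero_or_pos c with rfl | h
      · exact isCut_zero A
      · exact hcut h.ne'
    have hhigh : ∀ e ∈ A.filter (fun e => c ≤ e.1), c ≤ e.1 ∧ c ≤ e.2 := by
      intro e he
      obtain ⟨he, hce⟩ := Finset.mem_filter.1 he
      have := hcut e he
      omega
    refine Finset.mem_coe.2 (Finset.mem_product.2 ⟨mem_forests.2 ⟨⟨?_, hi⟩, hlin.mono
      (Finset.filter_subset _ _)⟩, mem_irredForests.2 ⟨mem_forests.2 ⟨⟨?_, ?_⟩, ?_⟩, ?_⟩⟩)
    · intro e he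
      obtain ⟨he, hce⟩ := Finset.mem_filter.1 he
      have h1 := hcut e he
      have h2 := mem_arcs.1 (hAE he)
      exact mem_arcs.2 (by omega)
    · intro e' he'
      obtain ⟨e, he, rfl⟩ := Finset.mem_image.1 he'
      have h1 := hhigh e he
      have h2 := mem_arcs.1 (hAE (Finset.mem_filter.1 he).1)
      exact mem_arcs.2 (by dsimp only [unshiftArc]; omega)
    · rw [Finset.card_image_of_injOn]
      · have := Finset.card_filter_add_card_filter_not (s := A) (fun e => e.1 < c)
        simp only [not_lt] at this
        omega
      · intro e he e' he' h
        have h1 := hhigh e he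
        have h2 := hhigh e' he'
        rw [← shift_unshiftArc h1.1 h1.2, h, shift_unshiftArc h2.1 h2.2]
    · exact (hlin.mono (Finset.filter_subset _ _)).unshift hhigh
    · intro c' hc' hc'n hcut'
      refine hmax (n := c + c') (by omega) (by omega) ?_
      intro e he
      have h1 := hcut e he
      by_cases hce : c ≤ e.1
      · have := hcut' (unshiftArc c e) (Finset.mem_image_of_mem _ (Finset.mem_filter.2 ⟨he, hce⟩))
        dsimp only [unshiftArc] at this
        omega
      · omega
  · rintro ⟨A, B⟩ hp
    obtain ⟨hA, hB⟩ := Finset.mem_product.1 (Finset.mem_coe.1 hp)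
    obtain ⟨⟨hAE, hAc⟩, hAlin⟩ := mem_forests.1 hA
    obtain ⟨hB, hirr⟩ := mem_irredForests.1 hB
    obtain ⟨⟨hBE, hBc⟩, hBlin⟩ := mem_forests.1 hB
    dsimp only at hAE hAc hAlin hirr hBE hBc hBlin ⊢
    have hlow : ∀ e ∈ A, e.1 < c ∧ e.2 < c := fun e he => (mem_arcs.1 (hAE he)).1
    have hfilter : (A ∪ B.image (shiftArc c)).filter (fun e => e.1 < c) = A := by
      rw [Finset.filter_union, Finset.filter_true_of_mem fun e he => (hlow e he).1,
        Finset.filter_false_of_mem, Finset.union_empty]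
      intro e' he'
      obtain ⟨e, he, rfl⟩ := Finset.mem_image.1 he'
      simp [shiftArc]
    refine Finset.mem_coe.2 (Finset.mem_filter.2 ⟨mem_forests.2 ⟨⟨?_, ?_⟩,
      hAlin.union_shift hBlin hlow⟩, ?_, ?_⟩)
    · intro e' he'
      rcases Finset.mem_union.1 he' with he | he
      · have := mem_arcs.1 (hAE he)
        exact mem_arcs.2 (by omega)
      · obtain ⟨e, heB, rfl⟩ := Finset.mem_image.1 he
        have := mem_arcs.1 (hBE heB)
        exact mem_arcs.2 (by dsimp only [shiftArc]; omega)
    · rw [Finset.card_union_of_disjoint, Finset.card_image_of_injective _ (shiftArc_injective c),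
        hAc, hBc]
      rw [Finset.disjoint_left]
      intro e' he' h
      obtain ⟨e, he, rfl⟩ := Finset.mem_image.1 h
      have := hlow _ he'
      simp [shiftArc] at this
    · refine Nat.findGreatest_eq_iff.2 ⟨hc, fun _ => ?_, ?_⟩
      · intro e' he'
        rcases Finset.mem_union.1 he' with he | he
        · exact Or.inl (hlow _ he)
        · obtain ⟨e, he, rfl⟩ := Finset.mem_image.1 he
          exact Or.inr (by simp [shiftArc])
      · intro c' hcc' hc'n hcut
        refine hirr (c' - c) (by omega) (by omega) ?_
        intro e he
        have := hcut (shiftArc c e) (Finset.mem_union_right _ (Finset.mem_image_of_mem _ he))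
        dsimp only [shiftArc] at this
        omega
    · rw [hfilter, hAc]
  · intro A hA
    obtain ⟨hA, hcut, hi⟩ := Finset.mem_filter.1 hA
    obtain ⟨-, hcut, -⟩ := Nat.findGreatest_eq_iff.1 hcut
    have hcut : IsCut A c := by
      rcases Nat.eq_zero_or_pos c with rfl | h
      · exact isCut_zero A
      · exact hcut h.ne'
    dsimp only
    rw [Finset.image_image, Finset.image_congr (g := id), Finset.image_id]
    · have := Finset.filter_union_filter_not_eq (fun e : ℕ × ℕ => e.1 < c) A
      simpa only [not_lt] using this
    · intro e he
      obtain ⟨he, hce⟩ := Finset.mem_filter.1 (Finset.mem_coe.1 he)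
      have := hcut e he
      exact shift_unshiftArc hce (by omega)
  · rintro ⟨A, B⟩ hp
    obtain ⟨hA, hB⟩ := Finset.mem_product.1 (Finset.mem_coe.1 hp)
    obtain ⟨⟨hAE, -⟩, -⟩ := mem_forests.1 hA
    have hlow : ∀ e ∈ A, e.1 < c ∧ e.2 < c := fun e he => (mem_arcs.1 (hAE he)).1
    dsimp only
    refine Prod.ext ?_ ?_
    · dsimp only
      rw [Finset.filter_union, Finset.filter_true_of_mem fun e he => (hlow e he).1,
        Finset.filter_false_of_mem, Finset.union_empty]
      intro e' he'
      obtain ⟨e, he, rfl⟩ := Finset.mem_image.1 he'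
      simp [shiftArc]
    · dsimp only
      rw [Finset.filter_union, Finset.filter_false_of_mem, Finset.empty_union,
        Finset.filter_true_of_mem, Finset.image_image]
      · rw [Finset.image_congr (g := id), Finset.image_id]
        intro e _
        exact unshift_shiftArc c e
      · intro e' he'
        obtain ⟨e, he, rfl⟩ := Finset.mem_image.1 he'
        simp [shiftArc]
      · intro e he
        have := hlow e he
        omega

/-- Classify by the position of the last cut and the number of arcs below it; what lies above is
irreducible. -/
theorem card_forests_succ (n d a : ℕ) :
    (forests (n + 1) d a).card = ∑ c ∈ Finset.range (n + 1), ∑ i ∈ Finset.range (a + 1),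
      (forests c d i).card * (irredForests (n + 1 - c) d (a - i)).card := by
  classical
  rw [← Finset.sum_product', Finset.card_eq_sum_card_fiberwise
    (f := fun A => (Nat.findGreatest (IsCut A) n,
      (A.filter fun e => e.1 < Nat.findGreatest (IsCut A) n).card))
    (t := Finset.range (n + 1) ×ˢ Finset.range (a + 1))]
  · refine Finset.sum_congr rfl fun p hp => ?_
    obtain ⟨c, i⟩ := p
    simp only [Finset.mem_product, Finset.mem_range] at hp
    have := card_forests_lastCut n d c i (a - i) (by omega)
    rw [show i + (a - i) = a by omega] at this
    rw [← this]
    congr 1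
    ext A
    simp only [Finset.mem_filter, Prod.mk.injEq]
    constructor
    · rintro ⟨h, rfl, rfl⟩
      exact ⟨h, rfl, rfl⟩
    · rintro ⟨h, rfl, rfl⟩
      exact ⟨h, rfl, rfl⟩
  · intro A hA
    have hA := mem_forests.1 (Finset.mem_coe.1 hA)
    refine Finset.mem_coe.2 (Finset.mem_product.2 ⟨?_, ?_⟩)
    · exact Finset.mem_range.2 (Nat.lt_succ_of_le (Nat.findGreatest_le n))
    · refine Finset.mem_range.2 (Nat.lt_succ_of_le ?_)
      rw [← hA.1.2]
      exact Finset.card_filter_le _ _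

/-- An arc crosses at most `d` gaps, so `a` arcs cannot cross all `n - 1` inner gaps. -/
theorem irredForests_eq_empty {n d a : ℕ} (h : a * d + 1 < n) : irredForests n d a = ∅ := by
  classical
  refine Finset.eq_empty_of_forall_notMem fun A hA => ?_
  obtain ⟨hA, hirr⟩ := mem_irredForests.1 hA
  obtain ⟨⟨hAE, hAc⟩, -⟩ := mem_forests.1 hA
  have hsub : Finset.Ioo 0 n ⊆ A.biUnion fun e => Finset.Ioc (min e.1 e.2) (max e.1 e.2) := by
    intro c hc
    obtain ⟨hc0, hcn⟩ := Finset.mem_Ioo.1 hc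
    have := hirr c hc0 hcn
    unfold IsCut at this
    push Not at this
    obtain ⟨e, he, h⟩ := this
    exact Finset.mem_biUnion.2 ⟨e, he, Finset.mem_Ioc.2 (by omega)⟩
  have := (Finset.card_le_card hsub).trans
    (Finset.card_biUnion_le_card_mul A _ d fun e he => by
      have := mem_arcs.1 (hAE he)
      rw [Nat.card_Ioc]
      omega)
  rw [Nat.card_Ioo, hAc] at this
  omega

theorem card_forests_zero (n d : ℕ) : (forests n d 0).card = 1 := by
  have : forests n d 0 = {∅} := by
    ext A
    rw [mem_forests, Finset.card_eq_zero, Finset.mem_singleton]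
    constructor
    · exact fun h => h.1.2
    · rintro rfl
      exact ⟨⟨by simp, rfl⟩, linForest_empty⟩
  simp [this]

theorem card_irredForests_one (d a : ℕ) :
    (irredForests 1 d a).card = if a = 0 then 1 else 0 := by
  have h : irredForests 1 d a = forests 1 d a := by
    ext A
    rw [mem_irredForests]
    constructor
    · exact fun h => h.1
    · exact fun h => ⟨h, by omega⟩
  rw [h]
  split_ifs with ha
  · rw [ha, card_forests_zero]
  · rw [Finset.card_eq_zero]
    refine Finset.eq_empty_of_forall_notMem fun A hA => ?_
    obtain ⟨⟨hAE, hAc⟩, -⟩ := mem_forests.1 hA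
    have : arcs 1 d = ∅ := by
      refine Finset.eq_empty_of_forall_notMem fun e he => ?_
      have := mem_arcs.1 he
      omega
    rw [this, Finset.subset_empty] at hAE
    rw [hAE] at hAc
    simp at hAc
    omega

/-- The last cut at `c = n` leaves a single point above and reproduces `forests n d a`. Otherwise
the top block has `s + 2` points, which forces at least one arc in it (hence `i < a`) and `s < a *
d`. The ranges and weights on the right do not depend on `n`, so polynomiality passes from smaller
`i` to `a`. -/
theorem card_forests_succ_sub {n d a : ℕ} (h : a * d ≤ n) :
    ((forests (n + 1) d a).card : ℝ) - (forests n d a).card =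
      ∑ s ∈ Finset.range (a * d), ∑ i ∈ Finset.range a,
        (forests (n - (s + 1)) d i).card * ((irredForests (s + 2) d (a - i)).card : ℝ) := by
  have h1 : (forests (n + 1) d a).card = (forests n d a).card +
      ∑ s ∈ Finset.range (a * d), ∑ i ∈ Finset.range a,
        (forests (n - (s + 1)) d i).card * (irredForests (s + 2) d (a - i)).card := by
    rw [card_forests_succ, Finset.sum_range_succ, add_comm]
    congr 1
    · rw [Finset.sum_eq_single a]
      · simp [card_irredForests_one]
      · intro i hi hia
        have hi := Finset.mem_range.1 hi
        rw [Nat.add_sub_cancel_left, card_irredForests_one, if_neg (by omega), mul_zero]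
      · simp
    · rw [← Finset.sum_range_reflect]
      rw [← Finset.sum_subset (Finset.range_subset_range.2 h)]
      · refine Finset.sum_congr rfl fun s hs => ?_
        have hs := Finset.mem_range.1 hs
        rw [Finset.sum_range_succ, Nat.sub_self, irredForests_eq_empty (a := 0) (by omega),
          Finset.card_empty, mul_zero, add_zero]
        refine Finset.sum_congr rfl fun i _ => ?_
        rw [show n - 1 - s = n - (s + 1) by omega,
          show n + 1 - (n - (s + 1)) = s + 2 by omega]
      · intro s hs hs'
        have hs := Finset.mem_range.1 hs
        have hs' : ¬ s < a * d := fun h => hs' (Finset.mem_range.2 h)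
        refine Finset.sum_eq_zero fun i _ => ?_
        have : (a - i) * d ≤ a * d := Nat.mul_le_mul_right d (Nat.sub_le a i)
        rw [irredForests_eq_empty (by omega), Finset.card_empty, mul_zero]
  rw [h1]
  push_cast
  ring

theorem exists_poly_sum_range (p : Polynomial ℝ) :
    ∃ q : Polynomial ℝ, ∀ k : ℕ, ∑ j ∈ Finset.range k, p.eval (j : ℝ) = q.eval (k : ℝ) := by
  induction p using Polynomial.induction_on' with
  | add p q hp hq =>
    obtain ⟨p', hp⟩ := hp
    obtain ⟨q', hq⟩ := hq
    exact ⟨p' + q', fun k => by simp [Finset.sum_add_distrib, hp, hq]⟩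
  | monomial r c =>
    refine ⟨Polynomial.C c * ∑ i ∈ Finset.range (r + 1),
      Polynomial.C ((bernoulli i : ℚ) * ((r + 1).choose i) / (r + 1) : ℝ) *
        Polynomial.X ^ (r + 1 - i), fun k => ?_⟩
    have h := congrArg (Rat.cast : ℚ → ℝ) (sum_range_pow k r)
    push_cast at h
    simp only [Polynomial.eval_monomial, Polynomial.eval_mul, Polynomial.eval_C,
      Polynomial.eval_finsetSum, Polynomial.eval_pow, Polynomial.eval_X]
    rw [← Finset.mul_sum, h]
    congr 1
    refine Finset.sum_congr rfl fun i _ => ?_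
    ring

/-- `f` agrees with a polynomial on the integers `≥ N`. -/
def PolyFrom (N : ℕ) (f : ℕ → ℝ) : Prop :=
  ∃ P : Polynomial ℝ, ∀ n, N ≤ n → f n = P.eval (n : ℝ)

theorem PolyFrom.mono {N M : ℕ} {f : ℕ → ℝ} (h : PolyFrom N f) (hNM : N ≤ M) : PolyFrom M f := by
  obtain ⟨P, hP⟩ := h
  exact ⟨P, fun n hn => hP n (hNM.trans hn)⟩

theorem PolyFrom.sum {ι : Type*} {N : ℕ} {s : Finset ι} {f : ι → ℕ → ℝ}
    (h : ∀ i ∈ s, PolyFrom N (f i)) : PolyFrom N fun n => ∑ i ∈ s, f i n := by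
  choose! P hP using h
  refine ⟨∑ i ∈ s, P i, fun n hn => ?_⟩
  rw [Polynomial.eval_finsetSum]
  exact Finset.sum_congr rfl fun i hi => hP i hi n hn

theorem PolyFrom.mul {N : ℕ} {f g : ℕ → ℝ} (hf : PolyFrom N f) (hg : PolyFrom N g) :
    PolyFrom N fun n => f n * g n := by
  obtain ⟨P, hP⟩ := hf
  obtain ⟨Q, hQ⟩ := hg
  exact ⟨P * Q, fun n hn => by dsimp only; rw [hP n hn, hQ n hn, Polynomial.eval_mul]⟩

theorem PolyFrom.const (N : ℕ) (c : ℝ) : PolyFrom N fun _ => c :=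
  ⟨Polynomial.C c, fun n _ => by simp⟩

theorem PolyFrom.pow {N : ℕ} {f : ℕ → ℝ} (hf : PolyFrom N f) (k : ℕ) :
    PolyFrom N fun n => f n ^ k := by
  obtain ⟨P, hP⟩ := hf
  exact ⟨P ^ k, fun n hn => by dsimp only; rw [hP n hn, Polynomial.eval_pow]⟩

theorem PolyFrom.shift {N : ℕ} {f : ℕ → ℝ} (hf : PolyFrom N f) (s : ℕ) :
    PolyFrom (N + s) fun n => f (n - s) := by
  obtain ⟨P, hP⟩ := hf
  refine ⟨P.comp (Polynomial.X - Polynomial.C (s : ℝ)), fun n hn => ?_⟩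
  dsimp only
  rw [hP (n - s) (by omega), Nat.cast_sub (by omega)]
  simp

theorem PolyFrom.of_succ_sub {N : ℕ} {f : ℕ → ℝ} (h : PolyFrom N fun n => f (n + 1) - f n) :
    PolyFrom N f := by
  obtain ⟨P, hP⟩ := h
  obtain ⟨Q, hQ⟩ := exists_poly_sum_range (P.comp (Polynomial.X + Polynomial.C (N : ℝ)))
  refine ⟨Polynomial.C (f N) + Q.comp (Polynomial.X - Polynomial.C (N : ℝ)), fun n hn => ?_⟩
  obtain ⟨k, rfl⟩ := Nat.exists_eq_add_of_le hn
  have h1 := Finset.sum_range_sub (fun j => f (N + j)) k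
  have h2 := hQ k
  have h3 : ∀ j ∈ Finset.range k, f (N + (j + 1)) - f (N + j) =
      (P.comp (Polynomial.X + Polynomial.C (N : ℝ))).eval (j : ℝ) := by
    intro j _
    have := hP (N + j) (by omega)
    dsimp only at this
    rw [add_assoc] at this
    rw [this]
    simp [add_comm]
  rw [Finset.sum_congr rfl h3, h2] at h1
  simp [h1]

theorem polyFrom_card_forests (d a : ℕ) :
    PolyFrom (a * (a * d)) fun n => ((forests n d a).card : ℝ) := by
  induction a using Nat.strong_induction_on with
  | _ a ih =>
    rcases Nat.eq_zero_or_pos a with rfl | ha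
    · simp only [card_forests_zero]
      exact PolyFrom.const _ _
    refine PolyFrom.of_succ_sub ?_
    have key : PolyFrom (a * (a * d)) fun n => ∑ s ∈ Finset.range (a * d), ∑ i ∈ Finset.range a,
        ((forests (n - (s + 1)) d i).card : ℝ) * (irredForests (s + 2) d (a - i)).card := by
      refine PolyFrom.sum fun s hs => PolyFrom.sum fun i hi => ?_
      have hs := Finset.mem_range.1 hs
      have hi := Finset.mem_range.1 hi
      -- The thresholds fit: `i²d + (s + 1) ≤ i·(a·d) + a·d ≤ a·(a·d)`.
      refine (((ih i hi).shift (s + 1)).mono ?_).mul (PolyFrom.const _ _)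
      have h1 : i * (i * d) ≤ i * (a * d) := by gcongr
      have h2 : (i + 1) * (a * d) ≤ a * (a * d) := by gcongr; omega
      rw [add_mul, one_mul] at h2
      omega
    obtain ⟨P, hP⟩ := key
    refine ⟨P, fun n hn => ?_⟩
    rw [← hP n hn]
    exact card_forests_succ_sub ((Nat.le_mul_of_pos_left _ ha).trans hn)

theorem polyFrom_centredCount (d b : ℕ) :
    PolyFrom (b * (b * d) + d) fun n => centredCount n d b := by
  unfold centredCount
  refine PolyFrom.sum fun a ha => ?_
  have ha : a ≤ b := Nat.lt_succ_iff.1 (Finset.mem_range.1 ha)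
  refine ((PolyFrom.const _ _).mul (PolyFrom.pow ?_ _)).mul ((PolyFrom.const _ _).mul
    ((polyFrom_card_forests d a).mono ?_))
  · refine ⟨-(Polynomial.C (2 * d : ℝ) * Polynomial.X - Polynomial.C (d * (d + 1) : ℝ)),
      fun n hn => ?_⟩
    dsimp only
    rw [card_arcs_eq (by omega)]
    simp
  · have : a * (a * d) ≤ b * (b * d) := by gcongr
    omega

/-! ### Degree bound and interpolation of the centred counts -/

theorem natDegree_le_of_growth {P : Polynomial ℝ} {N D : ℕ} {c : ℝ}
    (h : ∀ n : ℕ, N ≤ n → |P.eval (n : ℝ)| ≤ c * (n : ℝ) ^ D) : P.natDegree ≤ D := by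
  by_contra hlt
  push Not at hlt
  have hdeg : (Polynomial.X ^ D : Polynomial ℝ).degree < P.degree := by
    rw [Polynomial.degree_X_pow]
    exact Polynomial.coe_lt_degree.2 hlt
  have ht := Polynomial.abs_div_tendsto_atTop_atTop_of_degree_gt P (Polynomial.X ^ D) hdeg
    (pow_ne_zero _ Polynomial.X_ne_zero)
  have ht' := ht.comp tendsto_natCast_atTop_atTop
  obtain ⟨n, hn, hnN⟩ := ((ht'.eventually_gt_atTop c).and
    (Filter.eventually_ge_atTop (max N 1))).exists
  have hpos : (0 : ℝ) < (n : ℝ) ^ D := by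
    have : 1 ≤ n := le_trans (le_max_right _ _) hnN
    positivity
  have := h n (le_trans (le_max_left _ _) hnN)
  simp only [Function.comp, Polynomial.eval_pow, Polynomial.eval_X, abs_div, abs_of_pos hpos] at hn
  rw [lt_div_iff₀ hpos] at hn
  linarith

/-- The growth bound forces degree at most `b / 2`, so `b / 2 + 1` values just above the threshold
determine the polynomial. The nodes are linear in `d`, which makes the values there polynomially
bounded in `d`. -/
theorem centredCount_eq_interpolation {n d b : ℕ} (hn : b * (b * d) + d ≤ n) :
    centredCount n d b = ∑ i ∈ Finset.range (b / 2 + 1),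
      centredCount (b * (b * d) + d + i) d b *
        ∏ j ∈ (Finset.range (b / 2 + 1)).erase i,
          (((i : ℝ) - j)⁻¹ * (n - ((b * (b * d) + d + j : ℕ) : ℝ))) := by
  obtain ⟨P, hP⟩ := polyFrom_centredCount d b
  dsimp only at hP
  have hdeg : P.natDegree ≤ b / 2 := by
    refine natDegree_le_of_growth (N := b * (b * d) + d) (c := (32 * b * (d + 1) : ℝ) ^ b) ?_
    intro n hn
    rw [← hP n hn]
    exact abs_centredCount_le n d b
  have hinj : Set.InjOn (fun i : ℕ => ((b * (b * d) + d + i : ℕ) : ℝ))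
      (Finset.range (b / 2 + 1)) := by
    intro i _ j _ h
    dsimp only at h
    have : b * (b * d) + d + i = b * (b * d) + d + j := by exact_mod_cast h
    omega
  have hint := Lagrange.eq_interpolate hinj (f := P) (by
    rw [Finset.card_range]
    refine lt_of_le_of_lt Polynomial.degree_le_natDegree ?_
    exact_mod_cast Nat.lt_succ_of_le hdeg)
  rw [hP n hn]
  conv_lhs => rw [hint]
  rw [Lagrange.interpolate_apply, Polynomial.eval_finsetSum]
  refine Finset.sum_congr rfl fun i _ => ?_
  rw [hP (b * (b * d) + d + i) (by omega), Polynomial.eval_mul, Polynomial.eval_C, Lagrange.basis,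
    Polynomial.eval_prod]
  congr 1
  refine Finset.prod_congr rfl fun j _ => ?_
  simp [Lagrange.basisDivisor]

/-! ### Expansions in powers of `1 / n` with polynomially bounded coefficients -/

/-- The standard polynomial bounds `K (d + 1) ^ K`. -/
def polyBound (K d : ℕ) : ℕ := K * (d + 1) ^ K

theorem polyBound_mono {K L : ℕ} (h : K ≤ L) (d : ℕ) : polyBound K d ≤ polyBound L d :=
  Nat.mul_le_mul h (Nat.pow_le_pow_right (by omega) h)

theorem le_polyBound (K d : ℕ) : K ≤ polyBound K d :=
  Nat.le_mul_of_pos_right _ (by positivity)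

theorem polyBound_add_le (K L d : ℕ) :
    polyBound K d + polyBound L d ≤ polyBound (K + L) d := by
  unfold polyBound
  rw [add_mul]
  gcongr <;> omega

theorem polyBound_mul_le (K L d : ℕ) :
    polyBound K d * polyBound L d ≤ polyBound ((K + 1) * (L + 1)) d := by
  unfold polyBound
  calc K * (d + 1) ^ K * (L * (d + 1) ^ L) = (K * L) * (d + 1) ^ (K + L) := by
        rw [pow_add]; ring
    _ ≤ _ := by
      gcongr
      · omega
      · omega
      · omega
      · nlinarith

/-- `|c d|` is at most some `polyBound K d`. -/
def PolyBounded (c : ℕ → ℝ) : Prop := ∃ K : ℕ, ∀ d, |c d| ≤ polyBound K d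

theorem PolyBounded.add {c c' : ℕ → ℝ} (h : PolyBounded c) (h' : PolyBounded c') :
    PolyBounded fun d => c d + c' d := by
  obtain ⟨K, h⟩ := h
  obtain ⟨L, h'⟩ := h'
  refine ⟨K + L, fun d => ?_⟩
  have := polyBound_add_le K L d
  have : (polyBound K d : ℝ) + polyBound L d ≤ polyBound (K + L) d := by exact_mod_cast this
  linarith [abs_add_le (c d) (c' d), h d, h' d]

theorem PolyBounded.mul {c c' : ℕ → ℝ} (h : PolyBounded c) (h' : PolyBounded c') :
    PolyBounded fun d => c d * c' d := by
  obtain ⟨K, h⟩ := h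
  obtain ⟨L, h'⟩ := h'
  refine ⟨(K + 1) * (L + 1), fun d => ?_⟩
  have := polyBound_mul_le K L d
  have : (polyBound K d : ℝ) * polyBound L d ≤ polyBound ((K + 1) * (L + 1)) d := by
    exact_mod_cast this
  rw [abs_mul]
  exact (mul_le_mul (h d) (h' d) (abs_nonneg _) (by positivity)).trans this

theorem PolyBounded.of_le {c c' : ℕ → ℝ} (h : PolyBounded c') (hle : ∀ d, |c d| ≤ c' d) :
    PolyBounded c := by
  obtain ⟨K, h⟩ := h
  exact ⟨K, fun d => (hle d).trans ((le_abs_self _).trans (h d))⟩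

theorem PolyBounded.const (a : ℝ) : PolyBounded fun _ => a := by
  obtain ⟨K, hK⟩ := exists_nat_ge |a|
  refine ⟨K, fun d => hK.trans ?_⟩
  exact_mod_cast le_polyBound K d

theorem PolyBounded.id : PolyBounded fun d => (d : ℝ) := by
  refine ⟨1, fun d => ?_⟩
  simp [polyBound]

theorem PolyBounded.pow {c : ℕ → ℝ} (h : PolyBounded c) (k : ℕ) :
    PolyBounded fun d => c d ^ k := by
  induction k with
  | zero => simpa using PolyBounded.const 1
  | succ k ih => simpa only [pow_succ] using ih.mul h

theorem PolyBounded.abs {c : ℕ → ℝ} (h : PolyBounded c) : PolyBounded fun d => |c d| := by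
  obtain ⟨K, h⟩ := h
  exact ⟨K, fun d => by simpa using h d⟩

theorem PolyBounded.sum {ι : Type*} (s : Finset ι) {c : ι → ℕ → ℝ}
    (h : ∀ i ∈ s, PolyBounded (c i)) : PolyBounded fun d => ∑ i ∈ s, c i d := by
  classical
  induction s using Finset.induction_on with
  | empty => simpa using PolyBounded.const 0
  | insert a s ha ih =>
    simp only [Finset.sum_insert ha]
    exact (h a (Finset.mem_insert_self _ _)).add
      (ih fun i hi => h i (Finset.mem_insert_of_mem hi))

theorem PolyBounded.polynomiallyBounded {c : ℕ → ℝ} (h : PolyBounded c) :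
    PolynomiallyBounded c := by
  obtain ⟨K, h⟩ := h
  refine ⟨Polynomial.C (K : ℝ) * (Polynomial.X + 1) ^ K, fun d => (h d).trans ?_⟩
  simp [polyBound]

/-- `φ d n` has an expansion in powers of `1 / n` up to order `t`, with polynomially bounded
coefficients, when `n` exceeds some polynomial bound in `d`. -/
def Expandable : ℕ → (ℕ → ℕ → ℝ) → Prop
  | 0, φ => ∃ K : ℕ, ∀ d n, polyBound K d ≤ n → |φ d n| ≤ polyBound K d
  | t + 1, φ => ∃ (c : ℕ → ℝ) (ψ : ℕ → ℕ → ℝ) (K : ℕ), PolyBounded c ∧ Expandable t ψ ∧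
      ∀ d n, polyBound K d ≤ n → φ d n = c d + ψ d n / n

namespace Expandable

theorem congr {t : ℕ} {φ φ' : ℕ → ℕ → ℝ} (h : Expandable t φ) (K : ℕ)
    (heq : ∀ d n, polyBound K d ≤ n → φ' d n = φ d n) : Expandable t φ' := by
  cases t with
  | zero =>
    obtain ⟨L, h⟩ := h
    refine ⟨K + L, fun d n hn => ?_⟩
    have h1 := polyBound_mono (Nat.le_add_right K L) d
    have h2 := polyBound_mono (Nat.le_add_left L K) d
    rw [heq d n (by omega)]
    refine (h d n (by omega)).trans ?_
    exact_mod_cast h2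
  | succ t =>
    obtain ⟨c, ψ, L, hc, hψ, h⟩ := h
    refine ⟨c, ψ, K + L, hc, hψ, fun d n hn => ?_⟩
    have h1 := polyBound_mono (Nat.le_add_right K L) d
    have h2 := polyBound_mono (Nat.le_add_left L K) d
    rw [heq d n (by omega), h d n (by omega)]

/-- A quantity of order `n ^ (-t)` expands with all coefficients zero, everything going into the
last remainder. -/
theorem of_abs_le {t : ℕ} {φ : ℕ → ℕ → ℝ} {c : ℕ → ℝ} (hc : PolyBounded c) (K : ℕ)
    (h : ∀ d n, polyBound K d ≤ n → |φ d n| ≤ c d / (n : ℝ) ^ t) : Expandable t φ := by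
  induction t generalizing φ K with
  | zero =>
    obtain ⟨L, hc⟩ := hc
    refine ⟨K + L, fun d n hn => ?_⟩
    have h1 := polyBound_mono (Nat.le_add_right K L) d
    have h2 := polyBound_mono (Nat.le_add_left L K) d
    have h3 := h d n (by omega)
    rw [pow_zero, div_one] at h3
    refine h3.trans ((le_abs_self _).trans ((hc d).trans ?_))
    exact_mod_cast h2
  | succ t ih =>
    refine ⟨fun _ => 0, fun d n => n * φ d n, K + 1, PolyBounded.const 0, ih (K + 1) ?_, ?_⟩
    · intro d n hn
      have h1 := polyBound_mono (Nat.le_add_right K 1) d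
      have h2 := le_polyBound (K + 1) d
      have hn0 : (0 : ℝ) < n := by exact_mod_cast (by omega : 0 < n)
      have h3 := h d n (by omega)
      rw [abs_mul, abs_of_pos hn0]
      refine (mul_le_mul_of_nonneg_left h3 hn0.le).trans (le_of_eq ?_)
      rw [pow_succ]
      field_simp
    · intro d n hn
      have h2 := le_polyBound (K + 1) d
      have hn0 : (0 : ℝ) < n := by exact_mod_cast (by omega : 0 < n)
      field_simp
      simp

theorem zero (t : ℕ) : Expandable t fun _ _ => 0 :=
  of_abs_le (PolyBounded.const 0) 0 fun d n _ => by simp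

theorem const {c : ℕ → ℝ} (hc : PolyBounded c) (t : ℕ) : Expandable t fun d _ => c d := by
  cases t with
  | zero => exact of_abs_le hc.abs 0 fun d n _ => by simp
  | succ t => exact ⟨c, fun _ _ => 0, 0, hc, zero t, fun d n _ => by simp⟩

theorem add {t : ℕ} {φ φ' : ℕ → ℕ → ℝ} (h : Expandable t φ) (h' : Expandable t φ') :
    Expandable t fun d n => φ d n + φ' d n := by
  induction t generalizing φ φ' with
  | zero =>
    obtain ⟨K, h⟩ := h
    obtain ⟨L, h'⟩ := h'
    refine ⟨K + L, fun d n hn => ?_⟩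
    have h1 := polyBound_mono (Nat.le_add_right K L) d
    have h2 := polyBound_mono (Nat.le_add_left L K) d
    have h3 := polyBound_add_le K L d
    have h3 : (polyBound K d : ℝ) + polyBound L d ≤ polyBound (K + L) d := by exact_mod_cast h3
    linarith [abs_add_le (φ d n) (φ' d n), h d n (by omega), h' d n (by omega)]
  | succ t ih =>
    obtain ⟨c, ψ, K, hc, hψ, h⟩ := h
    obtain ⟨c', ψ', L, hc', hψ', h'⟩ := h'
    refine ⟨_, _, K + L, hc.add hc', ih hψ hψ', fun d n hn => ?_⟩
    have h1 := polyBound_mono (Nat.le_add_right K L) d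
    have h2 := polyBound_mono (Nat.le_add_left L K) d
    dsimp only
    rw [h d n (by omega), h' d n (by omega)]
    ring

theorem down {t : ℕ} {φ : ℕ → ℕ → ℝ} (h : Expandable (t + 1) φ) : Expandable t φ := by
  induction t generalizing φ with
  | zero =>
    obtain ⟨c, ψ, K, hc, ⟨L, hψ⟩, h⟩ := h
    have hb : PolyBounded fun d => |c d| + polyBound L d := hc.abs.add ⟨L, fun d => by simp⟩
    refine of_abs_le hb (K + (L + 1)) fun d n hn => ?_
    have h1 := polyBound_mono (Nat.le_add_right K (L + 1)) d
    have h2 := polyBound_mono (by omega : L ≤ K + (L + 1)) d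
    have h3 := le_polyBound (K + (L + 1)) d
    have hn1 : (1 : ℝ) ≤ n := by exact_mod_cast (by omega : 1 ≤ n)
    rw [h d n (by omega), pow_zero, div_one]
    refine (abs_add_le _ _).trans ?_
    gcongr
    rw [abs_div, Nat.abs_cast]
    exact (div_le_self (abs_nonneg _) hn1).trans (hψ d n (by omega))
  | succ t ih =>
    obtain ⟨c, ψ, K, hc, hψ, h⟩ := h
    exact ⟨c, ψ, K, hc, ih hψ, h⟩

theorem div_succ {t : ℕ} {φ : ℕ → ℕ → ℝ} (h : Expandable t φ) :
    Expandable (t + 1) fun d n => φ d n / n :=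
  ⟨fun _ => 0, φ, 0, PolyBounded.const 0, h, fun d n _ => by simp⟩

theorem div_nat {t : ℕ} {φ : ℕ → ℕ → ℝ} (h : Expandable t φ) :
    Expandable t fun d n => φ d n / n := h.div_succ.down

theorem mul {t : ℕ} {φ φ' : ℕ → ℕ → ℝ} (h : Expandable t φ) (h' : Expandable t φ') :
    Expandable t fun d n => φ d n * φ' d n := by
  induction t generalizing φ φ' with
  | zero =>
    obtain ⟨K, h⟩ := h
    obtain ⟨L, h'⟩ := h'
    have hb : PolyBounded fun d => (polyBound K d : ℝ) * polyBound L d :=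
      PolyBounded.mul ⟨K, fun d => by simp⟩ ⟨L, fun d => by simp⟩
    refine of_abs_le hb (K + L) fun d n hn => ?_
    have h1 := polyBound_mono (Nat.le_add_right K L) d
    have h2 := polyBound_mono (Nat.le_add_left L K) d
    rw [abs_mul, pow_zero, div_one]
    exact mul_le_mul (h d n (by omega)) (h' d n (by omega)) (abs_nonneg _) (by positivity)
  | succ t ih =>
    obtain ⟨c, ψ, K, hc, hψ, h⟩ := h
    obtain ⟨c', ψ', L, hc', hψ', h'⟩ := h'
    refine ⟨_, _, K + L, hc.mul hc', ((ih (const hc t) hψ').add (ih (const hc' t) hψ)).add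
      (ih hψ hψ').div_nat, fun d n hn => ?_⟩
    have h1 := polyBound_mono (Nat.le_add_right K L) d
    have h2 := polyBound_mono (Nat.le_add_left L K) d
    dsimp only
    rw [h d n (by omega), h' d n (by omega)]
    ring

theorem sum {ι : Type*} {t : ℕ} (s : Finset ι) {φ : ι → ℕ → ℕ → ℝ}
    (h : ∀ i ∈ s, Expandable t (φ i)) : Expandable t fun d n => ∑ i ∈ s, φ i d n := by
  classical
  induction s using Finset.induction_on with
  | empty => simpa using zero t
  | insert a s ha ih =>
    simp only [Finset.sum_insert ha]
    exact (h a (Finset.mem_insert_self _ _)).add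
      (ih fun i hi => h i (Finset.mem_insert_of_mem hi))

theorem prod {ι : Type*} {t : ℕ} (s : Finset ι) {φ : ι → ℕ → ℕ → ℝ}
    (h : ∀ i ∈ s, Expandable t (φ i)) : Expandable t fun d n => ∏ i ∈ s, φ i d n := by
  classical
  induction s using Finset.induction_on with
  | empty => simpa using const (PolyBounded.const 1) t
  | insert a s ha ih =>
    simp only [Finset.prod_insert ha]
    exact (h a (Finset.mem_insert_self _ _)).mul
      (ih fun i hi => h i (Finset.mem_insert_of_mem hi))

theorem pow {t : ℕ} {φ : ℕ → ℕ → ℝ} (h : Expandable t φ) (k : ℕ) :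
    Expandable t fun d n => φ d n ^ k := by
  have := prod (Finset.range k) (φ := fun _ => φ) fun _ _ => h
  simpa using this

theorem polynomial {t : ℕ} {φ : ℕ → ℕ → ℝ} (h : Expandable t φ) (P : Polynomial ℝ) :
    Expandable t fun d n => P.eval (φ d n) := by
  simp only [Polynomial.eval_eq_sum_range]
  exact sum _ fun i _ => (const (PolyBounded.const _) t).mul (h.pow i)

/-- Taylor's formula for `exp` at `a d / n`; requiring `n` to exceed the bound on `a d` keeps the
argument in `[-1, 1]`, where the remainder estimate applies. -/
theorem exp_sub_one {a : ℕ → ℝ} (ha : PolyBounded a) (t : ℕ) :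
    Expandable t fun d n => n * (Real.exp (a d / n) - 1) := by
  obtain ⟨K, hK⟩ := ha
  have ha : PolyBounded a := ⟨K, hK⟩
  have h1 : Expandable t fun d n =>
      ∑ m ∈ Finset.range t, (a d / n) ^ m * (a d * ((m + 1).factorial : ℝ)⁻¹) :=
    sum _ fun m _ => ((const ha t).div_nat.pow m).mul
      ((const ha t).mul (const (PolyBounded.const _) t))
  have h2 : Expandable t fun d n => n * (Real.exp (a d / n) -
      ∑ m ∈ Finset.range (t + 1), (a d / n) ^ m / m.factorial) := by
    refine of_abs_le ((ha.abs.pow (t + 1)).mul (PolyBounded.const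
      (((t + 1).succ : ℝ) / ((t + 1).factorial * (t + 1 : ℕ))))) (K + 1) fun d n hn => ?_
    have h3 := le_polyBound (K + 1) d
    have h4 := polyBound_mono (Nat.le_add_right K 1) d
    have hn0 : (0 : ℝ) < n := by exact_mod_cast (by omega : 0 < n)
    have hx : |a d / n| ≤ 1 := by
      rw [abs_div, Nat.abs_cast, div_le_one hn0]
      refine (hK d).trans ?_
      exact_mod_cast h4.trans hn
    have := Real.exp_bound hx (n := t + 1) (by omega)
    rw [abs_mul, Nat.abs_cast]
    refine (mul_le_mul_of_nonneg_left this hn0.le).trans (le_of_eq ?_)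
    rw [abs_div, Nat.abs_cast, div_pow, pow_succ (n : ℝ)]
    field_simp
  refine (h1.add h2).congr 1 fun d n hn => ?_
  have h3 := le_polyBound 1 d
  have hn0 : (0 : ℝ) < n := by exact_mod_cast (by omega : 0 < n)
  rw [Finset.sum_range_succ', pow_zero, Nat.factorial_zero, Nat.cast_one, div_one, mul_sub, mul_sub,
    mul_add, Finset.mul_sum]
  have : ∀ m ∈ Finset.range t, (n : ℝ) * ((a d / n) ^ (m + 1) / (m + 1).factorial) =
      (a d / n) ^ m * (a d * ((m + 1).factorial : ℝ)⁻¹) := by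
    intro m _
    rw [pow_succ]
    field_simp
  rw [Finset.sum_congr rfl this]
  ring

theorem exists_coeff {t : ℕ} {φ : ℕ → ℕ → ℝ} (h : Expandable t φ) :
    ∃ (c : ℕ → ℕ → ℝ) (K : ℕ), (∀ i, PolyBounded (c i)) ∧ ∀ d n, polyBound K d ≤ n →
      |φ d n - ∑ i ∈ Finset.range t, c i d / (n : ℝ) ^ i| ≤ polyBound K d / (n : ℝ) ^ t := by
  induction t generalizing φ with
  | zero =>
    obtain ⟨K, h⟩ := h
    exact ⟨fun _ _ => 0, K, fun _ => PolyBounded.const 0, fun d n hn => by simpa using h d n hn⟩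
  | succ t ih =>
    obtain ⟨c, ψ, K, hc, hψ, h⟩ := h
    obtain ⟨c', L, hc', h'⟩ := ih hψ
    refine ⟨fun i => Nat.casesOn i c c', K + L, fun i => ?_, fun d n hn => ?_⟩
    · cases i with
      | zero => exact hc
      | succ i => exact hc' i
    · have h1 := polyBound_mono (Nat.le_add_right K L) d
      have h2 := polyBound_mono (Nat.le_add_left L K) d
      rw [Finset.sum_range_succ', h d n (by omega)]
      have h3 := h' d n (by omega)
      change |c d + ψ d n / n - (∑ i ∈ Finset.range t, c' i d / (n : ℝ) ^ (i + 1) +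
          c d / (n : ℝ) ^ 0)| ≤ _
      have h4 : c d + ψ d n / n - (∑ i ∈ Finset.range t, c' i d / (n : ℝ) ^ (i + 1) +
          c d / (n : ℝ) ^ 0) = (ψ d n - ∑ i ∈ Finset.range t, c' i d / (n : ℝ) ^ i) / n := by
        rw [sub_div, Finset.sum_div]
        simp only [pow_succ, div_div]
        ring
      rw [h4, abs_div, Nat.abs_cast, pow_succ, ← div_div]
      gcongr
      refine h3.trans ?_
      gcongr

end Expandable

theorem exists_polyBounded_eval (Q : Polynomial ℝ) :
    ∃ c : ℕ → ℝ, PolyBounded c ∧ ∀ (d : ℕ) (x : ℝ), |x| ≤ 2 * d → |Q.eval x| ≤ c d := by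
  refine ⟨fun d => ∑ i ∈ Finset.range (Q.natDegree + 1), |Q.coeff i| * (2 * (d : ℝ)) ^ i,
    PolyBounded.sum _ fun i _ => (PolyBounded.const _).mul
      (((PolyBounded.const 2).mul PolyBounded.id).pow i), fun d x hx => ?_⟩
  rw [Polynomial.eval_eq_sum_range]
  refine (Finset.abs_sum_le_sum_abs _ _).trans (Finset.sum_le_sum fun i _ => ?_)
  rw [abs_mul, abs_pow]
  gcongr

/-! ### Reciprocals of falling factorials -/

/-- The coefficients of the expansion of `n ^ k / n.descFactorial k` in powers of `1 / n`. -/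
noncomputable def invDescCoeff : ℕ → ℕ → ℝ
  | 0, _ => 1
  | i + 1, k => ∑ j ∈ Finset.range k, (j : ℝ) * invDescCoeff i (j + 1)

theorem exists_poly_invDescCoeff (i : ℕ) :
    ∃ p : Polynomial ℝ, ∀ k : ℕ, invDescCoeff i k = p.eval (k : ℝ) := by
  induction i with
  | zero => exact ⟨1, fun k => by simp [invDescCoeff]⟩
  | succ i ih =>
    obtain ⟨p, hp⟩ := ih
    obtain ⟨q, hq⟩ := exists_poly_sum_range (Polynomial.X * p.comp (Polynomial.X + 1))
    refine ⟨q, fun k => ?_⟩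
    rw [← hq, invDescCoeff]
    refine Finset.sum_congr rfl fun j _ => ?_
    rw [hp]
    simp

theorem invDescCoeff_nonneg (i k : ℕ) : 0 ≤ invDescCoeff i k := by
  induction i generalizing k with
  | zero => simp [invDescCoeff]
  | succ i ih => exact Finset.sum_nonneg fun j _ => mul_nonneg (by positivity) (ih _)

theorem invDescCoeff_le (i k : ℕ) : invDescCoeff i k ≤ (k : ℝ) ^ (2 * i) := by
  induction i generalizing k with
  | zero => simp [invDescCoeff]
  | succ i ih =>
    refine (Finset.sum_le_card_nsmul _ _ ((k : ℝ) * (k : ℝ) ^ (2 * i)) fun j hj => ?_).trans ?_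
    · have hj := Finset.mem_range.1 hj
      have h1 : ((j + 1 : ℕ) : ℝ) ≤ k := by exact_mod_cast hj
      have h2 : (j : ℝ) ≤ k := by exact_mod_cast hj.le
      refine mul_le_mul h2 ((ih (j + 1)).trans ?_) (invDescCoeff_nonneg _ _) (by positivity)
      gcongr
    · rw [Finset.card_range, nsmul_eq_mul]
      apply le_of_eq
      ring

theorem descFactorial_pos {n k : ℕ} (h : k ≤ n) : (0 : ℝ) < n.descFactorial k := by
  have : n.descFactorial k ≠ 0 := by
    rw [Ne, Nat.descFactorial_eq_zero_iff_lt]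
    omega
  exact_mod_cast Nat.pos_of_ne_zero this

/-- Factor by factor `n / (n - j) ≤ k / (k - j)`, so the ratio is at most `k ^ k / k !`. Unlike the
expansion below, this holds for every `k ≤ n` and serves for the tail. -/
theorem pow_div_descFactorial_le_exp {n k : ℕ} (h : k ≤ n) :
    (n : ℝ) ^ k / n.descFactorial k ≤ Real.exp k := by
  have h1 : n ^ k * k.factorial ≤ n.descFactorial k * k ^ k := by
    rw [← Nat.descFactorial_self k, Nat.descFactorial_eq_prod_range, Nat.descFactorial_eq_prod_range]
    have h2 : ∏ j ∈ Finset.range k, n * (k - j) ≤ ∏ j ∈ Finset.range k, (n - j) * k := by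
      refine Finset.prod_le_prod' fun j hj => ?_
      have hj := Finset.mem_range.1 hj
      obtain ⟨a, rfl⟩ := Nat.exists_eq_add_of_le hj.le
      obtain ⟨b, rfl⟩ := Nat.exists_eq_add_of_le h
      rw [show j + a + b - j = a + b by omega, Nat.add_sub_cancel_left]
      nlinarith
    rw [Finset.prod_mul_distrib, Finset.prod_mul_distrib] at h2
    simpa using h2
  have h1' : (n : ℝ) ^ k * k.factorial ≤ n.descFactorial k * (k : ℝ) ^ k := by exact_mod_cast h1
  have h3 := Real.pow_div_factorial_le_exp (x := (k : ℝ)) (by positivity) k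
  have hf : (0 : ℝ) < k.factorial := by positivity
  rw [div_le_iff₀ hf] at h3
  rw [div_le_iff₀ (descFactorial_pos h)]
  have hd := descFactorial_pos h
  have : (n : ℝ) ^ k * k.factorial ≤ (Real.exp k * n.descFactorial k) * k.factorial := by
    calc _ ≤ _ := h1'
      _ ≤ n.descFactorial k * (Real.exp k * k.factorial) := by gcongr
      _ = _ := by ring
  exact le_of_mul_le_mul_right this hf

/-- With `r_k = n^k / (n)_k`, this is `(1 - k/n) r_(k+1) = r_k`, arranged so that telescoping gives
the recursion defining `invDescCoeff`. -/
theorem pow_div_descFactorial_succ {n k : ℕ} (h : k + 1 ≤ n) :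
    (n : ℝ) ^ (k + 1) / n.descFactorial (k + 1) =
      (n : ℝ) ^ k / n.descFactorial k + k / n * ((n : ℝ) ^ (k + 1) / n.descFactorial (k + 1)) := by
  have hd := descFactorial_pos (by omega : k ≤ n)
  have hn : (0 : ℝ) < n := by exact_mod_cast (by omega : 0 < n)
  have hnk : (0 : ℝ) < (n : ℝ) - k := by
    have : (k : ℝ) + 1 ≤ n := by exact_mod_cast h
    linarith
  rw [Nat.descFactorial_succ, Nat.cast_mul, Nat.cast_sub (by omega), pow_succ]
  field_simp
  ring

theorem pow_div_descFactorial_eq {n k : ℕ} (h : k ≤ n) :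
    (n : ℝ) ^ k / n.descFactorial k =
      1 + ∑ j ∈ Finset.range k, (j : ℝ) / n * ((n : ℝ) ^ (j + 1) / n.descFactorial (j + 1)) := by
  induction k with
  | zero => simp
  | succ k ih =>
    rw [Finset.sum_range_succ, ← add_assoc, ← ih (by omega)]
    exact pow_div_descFactorial_succ h

theorem pow_div_descFactorial_le_two {n k : ℕ} (hn : 0 < n) (h : 2 * k ^ 2 ≤ n) :
    (n : ℝ) ^ k / n.descFactorial k ≤ 2 := by
  have hn0 : (0 : ℝ) < n := by exact_mod_cast hn
  have hle : ∀ k : ℕ, k ≤ n → (n.descFactorial k : ℝ) ≤ (n : ℝ) ^ k := fun k _ => by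
    exact_mod_cast Nat.descFactorial_le_pow n k
  -- Bernoulli-type bound `(n)_j ≥ n^j (1 - j²/n)`, whose last factor is at least `1/2` in the
  -- stated range.
  have key : ∀ j : ℕ, j ≤ n → (n : ℝ) ^ j * (1 - j ^ 2 / n) ≤ n.descFactorial j := by
    intro j
    induction j with
    | zero => simp
    | succ j ih =>
      intro hj
      have ih := ih (by omega)
      have hl := hle j (by omega)
      rw [Nat.descFactorial_succ, Nat.cast_mul, Nat.cast_sub (by omega)]
      have hp : (0 : ℝ) < (n : ℝ) ^ j := by positivity
      have e1 : (n : ℝ) ^ (j + 1) * (1 - ((j + 1 : ℕ) : ℝ) ^ 2 / n) =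
          (n : ℝ) ^ j * (n - (j + 1) ^ 2) := by
        push_cast
        field_simp
        ring
      have e2 : (n : ℝ) ^ j * (1 - j ^ 2 / n) * n = (n : ℝ) ^ j * (n - j ^ 2) := by
        field_simp
      have h1 := mul_le_mul_of_nonneg_right ih hn0.le
      rw [e2] at h1
      rw [e1]
      have h2 : (j : ℝ) * n.descFactorial j ≤ j * (n : ℝ) ^ j := by gcongr
      nlinarith
  have hkn : k ≤ n := by nlinarith
  have h1 := key k hkn
  rw [div_le_iff₀ (descFactorial_pos hkn)]
  have h2 : (k : ℝ) ^ 2 / n ≤ 1 / 2 := by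
    rw [div_le_div_iff₀ hn0 (by norm_num)]
    have : (2 * k ^ 2 : ℝ) ≤ n := by exact_mod_cast h
    linarith
  have hp : (0 : ℝ) < (n : ℝ) ^ k := by positivity
  nlinarith

/-- By the telescoped identity, the next remainder at `k` is a sum of `k` earlier remainders with
weights at most `k / n`, so each order gains a factor `k ^ 2 / n`. -/
theorem pow_div_descFactorial_expansion {n k : ℕ} (hn : 0 < n) (h : 2 * k ^ 2 ≤ n) (t : ℕ) :
    0 ≤ (n : ℝ) ^ k / n.descFactorial k -
        ∑ i ∈ Finset.range t, invDescCoeff i k / (n : ℝ) ^ i ∧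
      (n : ℝ) ^ k / n.descFactorial k - ∑ i ∈ Finset.range t, invDescCoeff i k / (n : ℝ) ^ i ≤
        2 * ((k : ℝ) ^ 2 / n) ^ t := by
  have hn0 : (0 : ℝ) < n := by exact_mod_cast hn
  induction t generalizing k with
  | zero =>
    simp only [Finset.range_zero, Finset.sum_empty, sub_zero, pow_zero, mul_one]
    exact ⟨by positivity, pow_div_descFactorial_le_two hn h⟩
  | succ t ih =>
    have hkn : k ≤ n := by nlinarith
    have heq : (n : ℝ) ^ k / n.descFactorial k -
        ∑ i ∈ Finset.range (t + 1), invDescCoeff i k / (n : ℝ) ^ i =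
        ∑ j ∈ Finset.range k, (j : ℝ) / n * ((n : ℝ) ^ (j + 1) / n.descFactorial (j + 1) -
          ∑ i ∈ Finset.range t, invDescCoeff i (j + 1) / (n : ℝ) ^ i) := by
      rw [pow_div_descFactorial_eq hkn, Finset.sum_range_succ']
      simp only [invDescCoeff, mul_sub, Finset.sum_sub_distrib, pow_zero, div_one, Finset.mul_sum,
        Finset.sum_div]
      rw [Finset.sum_comm]
      have : ∀ j ∈ Finset.range k, ∀ i ∈ Finset.range t,
          (j : ℝ) * invDescCoeff i (j + 1) / (n : ℝ) ^ (i + 1) =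
          (j : ℝ) / n * (invDescCoeff i (j + 1) / (n : ℝ) ^ i) := by
        intro j _ i _
        rw [pow_succ]
        field_simp
      rw [Finset.sum_congr rfl fun j hj => Finset.sum_congr rfl (this j hj)]
      ring
    have hsmall : ∀ j ∈ Finset.range k, 2 * (j + 1) ^ 2 ≤ n := by
      intro j hj
      have hj := Finset.mem_range.1 hj
      have : (j + 1) ^ 2 ≤ k ^ 2 := Nat.pow_le_pow_left hj 2
      omega
    rw [heq]
    constructor
    · exact Finset.sum_nonneg fun j hj => mul_nonneg (by positivity) (ih (hsmall j hj)).1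
    · refine (Finset.sum_le_card_nsmul _ _ ((k : ℝ) / n * (2 * ((k : ℝ) ^ 2 / n) ^ t))
        fun j hj => ?_).trans ?_
      · have h1 := (ih (hsmall j hj)).2
        have hj := Finset.mem_range.1 hj
        have h2 : (j : ℝ) ≤ k := by exact_mod_cast hj.le
        have h3 : ((j + 1 : ℕ) : ℝ) ≤ k := by exact_mod_cast hj
        refine mul_le_mul (by gcongr) (h1.trans ?_) (ih (hsmall j (Finset.mem_range.2 hj))).1
          (by positivity)
        gcongr
      · rw [Finset.card_range, nsmul_eq_mul, pow_succ]
        apply le_of_eq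
        ring

/-- For a polynomial `p`, the series `∑ p(l) x ^ l / l !` is a polynomial in `x` times `exp x`. -/
theorem exists_hasSum_exp (p : Polynomial ℝ) :
    ∃ Q : Polynomial ℝ, ∀ x : ℝ,
      HasSum (fun l : ℕ => x ^ l / l.factorial * p.eval (l : ℝ)) (Q.eval x * Real.exp x) := by
  induction hN : p.natDegree using Nat.strong_induction_on generalizing p with
  | _ N ih =>
    have hexp : ∀ x : ℝ, HasSum (fun l : ℕ => x ^ l / l.factorial) (Real.exp x) := by
      intro x
      rw [Real.exp_eq_exp_ℝ]
      exact NormedSpace.expSeries_div_hasSum_exp x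
    rcases Nat.eq_zero_or_pos N with h0 | hpos
    · rw [h0] at hN
      rw [Polynomial.eq_C_of_natDegree_eq_zero hN]
      refine ⟨Polynomial.C (p.coeff 0), fun x => ?_⟩
      simpa [mul_comm] using (hexp x).mul_left (p.coeff 0)
    -- Write `p = p(0) + X * divX p`: the factor `l` cancels against `l !` and shifts the series,
    -- leaving `x` times the series of `divX p` at `l + 1`, of lower degree.
    · have hdeg : (p.divX.comp (Polynomial.X + Polynomial.C 1)).natDegree < N := by
        rw [Polynomial.natDegree_comp, Polynomial.natDegree_X_add_C, mul_one,
          Polynomial.natDegree_divX_eq_natDegree_tsub_one]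
        omega
      obtain ⟨Q, hQ⟩ := ih _ hdeg _ rfl
      refine ⟨Polynomial.C (p.coeff 0) + Polynomial.X * Q, fun x => ?_⟩
      have h1 : HasSum (fun l : ℕ => x ^ l / l.factorial * (l * p.divX.eval (l : ℝ)))
          (x * (Q.eval x * Real.exp x)) := by
        rw [← hasSum_nat_add_iff' 1]
        simp only [Finset.range_one, Finset.sum_singleton, CharP.cast_eq_zero, zero_mul, mul_zero,
          sub_zero]
        refine ((hQ x).mul_left x).congr_fun fun l => ?_
        rw [Nat.factorial_succ, pow_succ]
        push_cast
        simp only [Polynomial.eval_comp, Polynomial.eval_add, Polynomial.eval_X, Polynomial.eval_C]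
        have : (l : ℝ) + 1 ≠ 0 := by positivity
        field_simp
      have h2 := ((hexp x).mul_left (p.coeff 0)).add h1
      rw [Polynomial.eval_add, Polynomial.eval_mul, Polynomial.eval_X, Polynomial.eval_C, add_mul,
        mul_assoc]
      refine h2.congr_fun fun l => ?_
      conv_lhs => rw [← Polynomial.divX_mul_X_add p]
      simp only [Polynomial.eval_add, Polynomial.eval_mul, Polynomial.eval_X, Polynomial.eval_C]
      ring

/-! ### The asymptotic expansion -/

/-- The normalised centred counts. -/
noncomputable def normCount (n d b : ℕ) : ℝ := centredCount n d b / ((n : ℝ) ^ b * b.factorial)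

/-- The number of arcs per vertex. -/
noncomputable def arcDensity (n d : ℕ) : ℝ := (arcs n d).card / n

theorem arcDensity_nonneg (n d : ℕ) : 0 ≤ arcDensity n d := by
  unfold arcDensity
  positivity

theorem arcDensity_le (n d : ℕ) : arcDensity n d ≤ 2 * d := by
  rcases Nat.eq_zero_or_pos n with rfl | hn
  · simp [arcDensity]
  · have hn0 : (0 : ℝ) < n := by exact_mod_cast hn
    rw [arcDensity, div_le_iff₀ hn0]
    exact_mod_cast card_arcs_le n d

/-- The factor `b ^ b` is absorbed by `b !` through `b ^ b / b ! ≤ e ^ b`, and `n ^ (b / 2) / n ^ b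
≤ √n ^ (-b)`. -/
theorem abs_normCount_le {n : ℕ} (hn : 0 < n) (d b : ℕ) :
    |normCount n d b| ≤ (32 * Real.exp 1 * (d + 1) / √n) ^ b := by
  have hn1 : (1 : ℝ) ≤ n := by exact_mod_cast hn
  have hs1 : 1 ≤ √(n : ℝ) := Real.one_le_sqrt.2 hn1
  have hs0 : 0 < √(n : ℝ) := by linarith
  have hsq : √(n : ℝ) ^ 2 = n := Real.sq_sqrt (by linarith)
  have h1 := abs_centredCount_le n d b
  have h2 : (n : ℝ) ^ (b / 2) ≤ √(n : ℝ) ^ b := by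
    rw [← hsq, ← pow_mul]
    simp only [hsq]
    exact pow_le_pow_right₀ hs1 (by omega)
  have h3 := Real.pow_div_factorial_le_exp (x := (b : ℝ)) (by positivity) b
  have hf : (0 : ℝ) < b.factorial := by positivity
  rw [div_le_iff₀ hf] at h3
  have he : Real.exp b = Real.exp 1 ^ b := by rw [← Real.exp_nat_mul, mul_one]
  rw [he] at h3
  have hpos : 0 < (n : ℝ) ^ b * b.factorial := by positivity
  rw [normCount, abs_div, abs_of_pos hpos, div_le_iff₀ hpos]
  calc |centredCount n d b| ≤ (32 * b * (d + 1) : ℝ) ^ b * (n : ℝ) ^ (b / 2) := h1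
    _ = (32 * (d + 1) : ℝ) ^ b * (b : ℝ) ^ b * (n : ℝ) ^ (b / 2) := by
      rw [← mul_pow]
      ring
    _ ≤ (32 * (d + 1) : ℝ) ^ b * (Real.exp 1 ^ b * b.factorial) * √(n : ℝ) ^ b := by gcongr
    _ = (32 * Real.exp 1 * (d + 1) / √n) ^ b * ((√(n : ℝ) ^ 2) ^ b * b.factorial) := by
      rw [div_pow, ← pow_mul, mul_comm 2 b, pow_mul, sq]
      field_simp
      rw [← mul_pow]
    _ = _ := by rw [hsq]

theorem forests_div_descFactorial {n k : ℕ} (hn : 0 < n) (d : ℕ) :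
    ((forests n d k).card : ℝ) / n.descFactorial k =
      ∑ b ∈ Finset.range (k + 1), (n : ℝ) ^ k / n.descFactorial k * normCount n d b *
        (arcDensity n d ^ (k - b) / (k - b).factorial) := by
  have hn0 : (0 : ℝ) < n := by exact_mod_cast hn
  have h := factorial_mul_card_forests n d k
  have hk : (0 : ℝ) < k.factorial := by positivity
  have h' : ((forests n d k).card : ℝ) = ∑ b ∈ Finset.range (k + 1),
      (n : ℝ) ^ k * normCount n d b * (arcDensity n d ^ (k - b) / (k - b).factorial) := by
    rw [← mul_right_inj' hk.ne', h, Finset.mul_sum]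
    refine Finset.sum_congr rfl fun b hb => ?_
    have hb : b ≤ k := Nat.lt_succ_iff.1 (Finset.mem_range.1 hb)
    have hc : (k.factorial : ℝ) = k.choose b * b.factorial * (k - b).factorial := by
      exact_mod_cast (Nat.choose_mul_factorial_mul_factorial hb).symm
    have hp : (n : ℝ) ^ k = (n : ℝ) ^ b * (n : ℝ) ^ (k - b) := by
      rw [← pow_add, Nat.add_sub_cancel' hb]
    rw [hc, hp, normCount, arcDensity, div_pow]
    have hb' : (b.factorial : ℝ) ≠ 0 := by positivity
    field_simp
  rw [h', Finset.sum_div]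
  refine Finset.sum_congr rfl fun b _ => ?_
  ring

/-! ### Error terms: tail in `k`, large clusters, small clusters -/

theorem card_forests_le (n d k : ℕ) :
    ((forests n d k).card : ℝ) ≤ (2 * d * n : ℝ) ^ k / k.factorial := by
  classical
  have h1 : (forests n d k).card ≤ (arcs n d).card.choose k := by
    rw [← Finset.card_powersetCard]
    exact Finset.card_filter_le _ _
  have h2 : ((arcs n d).card.choose k : ℝ) ≤ ((arcs n d).card : ℝ) ^ k / k.factorial :=
    Nat.choose_le_pow_div _ _
  have h3 : ((arcs n d).card : ℝ) ≤ 2 * d * n := by exact_mod_cast card_arcs_le n d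
  calc ((forests n d k).card : ℝ) ≤ (arcs n d).card.choose k := by exact_mod_cast h1
    _ ≤ _ := h2
    _ ≤ _ := by gcongr

theorem hasSum_exp (x : ℝ) : HasSum (fun l : ℕ => x ^ l / l.factorial) (Real.exp x) := by
  rw [Real.exp_eq_exp_ℝ]
  exact NormedSpace.expSeries_div_hasSum_exp x

/-- For `k ≥ κ` one has `e ^ k ≤ e ^ (-κ) * e ^ (2 k)`; the spare factor makes the tail
exponentially small in `κ`, while the rest still sums to an exponential. -/
theorem abs_term_le {n d k κ : ℕ} (hn : 0 < n) (hkn : k ≤ n) (hk : κ ≤ k) :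
    |(-1 : ℝ) ^ k * (forests n d k).card / n.descFactorial k| ≤
      Real.exp (-κ) * ((Real.exp 2 * (2 * d)) ^ k / k.factorial) := by
  have hn0 : (0 : ℝ) < n := by exact_mod_cast hn
  have hd := descFactorial_pos hkn
  have h1 := card_forests_le n d k
  have h2 := pow_div_descFactorial_le_exp hkn
  rw [abs_div, abs_mul, abs_pow, abs_neg, abs_one, one_pow, one_mul, Nat.abs_cast, Nat.abs_cast]
  have h3 : Real.exp k ≤ Real.exp (-κ) * Real.exp 2 ^ k := by
    rw [← Real.exp_nat_mul, ← Real.exp_add]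
    apply Real.exp_le_exp.2
    have : (κ : ℝ) ≤ k := by exact_mod_cast hk
    linarith
  calc ((forests n d k).card : ℝ) / n.descFactorial k
      ≤ ((2 * d * n : ℝ) ^ k / k.factorial) / n.descFactorial k := by gcongr
    _ = (n : ℝ) ^ k / n.descFactorial k * ((2 * d : ℝ) ^ k / k.factorial) := by
      rw [mul_pow]
      ring
    _ ≤ (Real.exp (-κ) * Real.exp 2 ^ k) * ((2 * d : ℝ) ^ k / k.factorial) := by
      gcongr
      exact h2.trans h3
    _ = _ := by
      rw [mul_pow]
      ring

theorem abs_truncation_le {n d κ : ℕ} (hn : 0 < n) (hκ : κ ≤ n) :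
    |∑ k ∈ Finset.range (n + 1), (-1 : ℝ) ^ k * (forests n d k).card / n.descFactorial k -
      ∑ k ∈ Finset.range (κ + 1), (-1 : ℝ) ^ k * (forests n d k).card / n.descFactorial k| ≤
      Real.exp (Real.exp 2 * (2 * d) - κ) := by
  rw [← Finset.sum_Ico_eq_sub _ (by omega : κ + 1 ≤ n + 1)]
  refine (Finset.abs_sum_le_sum_abs _ _).trans ?_
  refine (Finset.sum_le_sum (g := fun k : ℕ =>
    Real.exp (-κ) * ((Real.exp 2 * (2 * d)) ^ k / k.factorial)) fun k hk => ?_).trans ?_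
  · have := Finset.mem_Ico.1 hk
    exact abs_term_le hn (by omega) (by omega)
  · rw [sub_eq_neg_add, Real.exp_add, ← Finset.mul_sum]
    gcongr
    exact sum_le_hasSum _ (fun k _ => by positivity) (hasSum_exp _)

/-- The contribution of clusters with `b` arcs, truncated at `N` arcs in total. -/
noncomputable def innerSum (n d N b : ℕ) : ℝ :=
  ∑ l ∈ Finset.range (N - b), (-1 : ℝ) ^ (b + l) *
    ((n : ℝ) ^ (b + l) / n.descFactorial (b + l)) * (arcDensity n d ^ l / l.factorial)

/-- Reorder by the cluster size `b`, with `k = b + l`. -/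
theorem sum_range_eq_innerSum {n : ℕ} (hn : 0 < n) (d N : ℕ) :
    ∑ k ∈ Finset.range N, (-1 : ℝ) ^ k * (forests n d k).card / n.descFactorial k =
      ∑ b ∈ Finset.range N, normCount n d b * innerSum n d N b := by
  have h : ∀ k ∈ Finset.range N, (-1 : ℝ) ^ k * (forests n d k).card / n.descFactorial k =
      ∑ b ∈ Finset.range (k + 1), (fun b l => normCount n d b * ((-1 : ℝ) ^ (b + l) *
        ((n : ℝ) ^ (b + l) / n.descFactorial (b + l)) *
          (arcDensity n d ^ l / l.factorial))) b (k - b) := by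
    intro k _
    rw [mul_div_assoc, forests_div_descFactorial hn, Finset.mul_sum]
    refine Finset.sum_congr rfl fun b hb => ?_
    have hb : b ≤ k := Nat.lt_succ_iff.1 (Finset.mem_range.1 hb)
    dsimp only
    rw [Nat.add_sub_cancel' hb]
    ring
  rw [Finset.sum_congr rfl h, Finset.sum_range_diag_flip N (fun b l => normCount n d b *
    ((-1 : ℝ) ^ (b + l) * ((n : ℝ) ^ (b + l) / n.descFactorial (b + l)) *
      (arcDensity n d ^ l / l.factorial)))]
  simp only [innerSum, Finset.mul_sum]

theorem sum_arcDensity_le (n d N : ℕ) :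
    ∑ l ∈ Finset.range N, arcDensity n d ^ l / l.factorial ≤ Real.exp (2 * d) :=
  (sum_le_hasSum _ (fun l _ => by have := arcDensity_nonneg n d; positivity) (hasSum_exp _)).trans
    (Real.exp_le_exp.2 (arcDensity_le n d))

theorem abs_innerSum_le {n d κ b : ℕ} (hn : 0 < n) (hκ : 2 * κ ^ 2 ≤ n) :
    |innerSum n d (κ + 1) b| ≤ 2 * Real.exp (2 * d) := by
  have hy := arcDensity_nonneg n d
  refine (Finset.abs_sum_le_sum_abs _ _).trans ?_
  refine (Finset.sum_le_sum (g := fun l : ℕ => 2 * (arcDensity n d ^ l / l.factorial))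
    fun l hl => ?_).trans ?_
  · have hl := Finset.mem_range.1 hl
    have h1 : (b + l) ^ 2 ≤ κ ^ 2 := Nat.pow_le_pow_left (by omega) 2
    have h2 := pow_div_descFactorial_le_two (k := b + l) hn (by omega)
    rw [abs_mul, abs_mul, abs_pow, abs_neg, abs_one, one_pow, one_mul, abs_of_nonneg (by positivity),
      abs_of_nonneg (by positivity)]
    gcongr
  · rw [← Finset.mul_sum]
    gcongr
    exact sum_arcDensity_le n d _

/-- A geometric series of ratio at most `1/2` starting at `b = 2t`, whose first term already has
order `n ^ (-t)`. -/
theorem abs_large_clusters_le {n d κ t : ℕ} (hn : 0 < n) (hκ : 2 * κ ^ 2 ≤ n) (ht : 2 * t ≤ κ)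
    (hρ : 32 * Real.exp 1 * (d + 1) / √n ≤ 1 / 2) :
    |∑ b ∈ Finset.range (κ + 1), normCount n d b * innerSum n d (κ + 1) b -
      ∑ b ∈ Finset.range (2 * t), normCount n d b * innerSum n d (κ + 1) b| ≤
      4 * (32 * Real.exp 1 * (d + 1)) ^ (2 * t) * Real.exp (2 * d) / (n : ℝ) ^ t := by
  have hn0 : (0 : ℝ) < n := by exact_mod_cast hn
  set ρ := 32 * Real.exp 1 * (d + 1) / √n with hρdef
  have hρ0 : 0 ≤ ρ := by positivity
  rw [← Finset.sum_Ico_eq_sub _ (by omega : 2 * t ≤ κ + 1)]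
  refine (Finset.abs_sum_le_sum_abs _ _).trans ?_
  refine (Finset.sum_le_sum (g := fun b : ℕ => ρ ^ b * (2 * Real.exp (2 * d)))
    fun b _ => ?_).trans ?_
  · rw [abs_mul]
    exact mul_le_mul (abs_normCount_le hn d b) (abs_innerSum_le hn hκ) (abs_nonneg _)
      (by positivity)
  · rw [← Finset.sum_mul]
    have h1 := geom_sum_Ico_le_of_lt_one (m := 2 * t) (n := κ + 1) hρ0 (by linarith)
    have h2 : ρ ^ (2 * t) / (1 - ρ) ≤ 2 * ρ ^ (2 * t) := by
      rw [div_le_iff₀ (by linarith)]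
      have : 0 ≤ ρ ^ (2 * t) := by positivity
      nlinarith
    have h3 : ρ ^ (2 * t) = (32 * Real.exp 1 * (d + 1)) ^ (2 * t) / (n : ℝ) ^ t := by
      rw [hρdef, div_pow, pow_mul √(n : ℝ), Real.sq_sqrt hn0.le]
    calc _ ≤ 2 * ρ ^ (2 * t) * (2 * Real.exp (2 * d)) := by
          gcongr
          exact h1.trans h2
      _ = _ := by
        rw [h3]
        ring

theorem abs_hasSum_sub_sum_range_le {F G : ℕ → ℝ} {A B : ℝ} {N : ℕ} (hF : HasSum F A)
    (hG : HasSum G B) (hG0 : ∀ l, 0 ≤ G l) (h : ∀ l, N ≤ l → |F l| ≤ G l) :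
    |A - ∑ l ∈ Finset.range N, F l| ≤ B := by
  have h1 := (hasSum_nat_add_iff' N).2 hF
  have h2 := (hasSum_nat_add_iff' N).2 hG
  have h3 : B - ∑ l ∈ Finset.range N, G l ≤ B := by
    have := Finset.sum_nonneg fun l (_ : l ∈ Finset.range N) => hG0 l
    linarith
  refine le_trans ?_ h3
  rw [abs_le]
  constructor
  · exact hasSum_le (fun l => (abs_le.1 (h (l + N) (by omega))).1) h2.neg h1
  · exact hasSum_le (fun l => (abs_le.1 (h (l + N) (by omega))).2) h1 h2

/-- The coefficients grow at most like `k ^ (2 i) ≤ (2 i)! * e ^ k`, and for `l ≥ κ - b` one has `e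
^ (b + l) ≤ e ^ (2 b - κ) * e ^ (2 l)`. -/
theorem abs_series_tail_le {Q : Polynomial ℝ} {i b κ N : ℕ} (hN : κ ≤ N + b) {y z : ℝ} (hy : 0 ≤ y)
    (hyz : y ≤ z) (hQ : HasSum (fun l : ℕ => (-y) ^ l / l.factorial * invDescCoeff i (b + l))
      (Q.eval (-y) * Real.exp (-y))) :
    |Q.eval (-y) * Real.exp (-y) -
      ∑ l ∈ Finset.range N, (-y) ^ l / l.factorial * invDescCoeff i (b + l)| ≤
      (2 * i).factorial * Real.exp (2 * b) * Real.exp (Real.exp 2 * z - κ) := by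
  have hG := (hasSum_exp (Real.exp 2 * y)).mul_left
    ((2 * i).factorial * Real.exp (2 * b) * Real.exp (-κ))
  refine (abs_hasSum_sub_sum_range_le hQ hG (fun l => by positivity) ?_).trans ?_
  · intro l hl
    have h1 := invDescCoeff_le i (b + l)
    have h2 := Real.pow_div_factorial_le_exp (x := ((b + l : ℕ) : ℝ)) (by positivity) (2 * i)
    rw [div_le_iff₀ (by positivity)] at h2
    have h3 : Real.exp ((b + l : ℕ) : ℝ) ≤ Real.exp (2 * b) * Real.exp (-κ) * Real.exp 2 ^ l := by
      rw [← Real.exp_nat_mul, ← Real.exp_add, ← Real.exp_add]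
      apply Real.exp_le_exp.2
      have : (κ : ℝ) ≤ l + b := by exact_mod_cast (by omega : κ ≤ l + b)
      push_cast
      linarith
    rw [abs_mul, abs_div, abs_pow, abs_neg, abs_of_nonneg hy, Nat.abs_cast,
      abs_of_nonneg (invDescCoeff_nonneg _ _)]
    calc y ^ l / l.factorial * invDescCoeff i (b + l)
        ≤ y ^ l / l.factorial *
          ((Real.exp (2 * b) * Real.exp (-κ) * Real.exp 2 ^ l) * (2 * i).factorial) := by
          gcongr
          refine h1.trans (h2.trans ?_)
          gcongr
      _ = _ := by
        rw [mul_pow]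
        ring
  · rw [sub_eq_neg_add, Real.exp_add, ← mul_assoc]
    gcongr

/-- Insert the expansion of `n ^ k / n.descFactorial k` and complete each of the `t` series. The
expansion remainder, of order `(k² / n) ^ t`, is summed exactly by the polynomial `R`; the completed
tails are small by the hypothesis on `κ`. -/
theorem exists_small_clusters (t b : ℕ) :
    ∃ (Q : ℕ → Polynomial ℝ) (c : ℕ → ℝ), PolyBounded c ∧ (b = 0 → Q 0 = 1) ∧
      ∀ n d κ : ℕ, 0 < n → 2 * κ ^ 2 ≤ n → 2 * t ≤ κ →
        Real.exp (Real.exp 2 * (2 * d) - κ) ≤ 1 / (n : ℝ) ^ t →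
        |innerSum n d (κ + 1) b - (-1) ^ b * Real.exp (-arcDensity n d) *
          ∑ i ∈ Finset.range t, (Q i).eval (-arcDensity n d) / (n : ℝ) ^ i| ≤
          c d * Real.exp (2 * d) / (n : ℝ) ^ t := by
  choose p hp using exists_poly_invDescCoeff
  have hQ' : ∀ i, ∃ Q : Polynomial ℝ, (b = 0 → i = 0 → Q = 1) ∧ ∀ x : ℝ,
      HasSum (fun l : ℕ => x ^ l / l.factorial * invDescCoeff i (b + l))
        (Q.eval x * Real.exp x) := by
    intro i
    by_cases h0 : i = 0
    · refine ⟨1, fun _ _ => rfl, fun x => ?_⟩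
      simpa [h0, invDescCoeff] using hasSum_exp x
    · obtain ⟨Q, hQ⟩ := exists_hasSum_exp ((p i).comp (Polynomial.X + Polynomial.C (b : ℝ)))
      refine ⟨Q, fun _ h => absurd h h0, fun x => (hQ x).congr_fun fun l => ?_⟩
      rw [hp]
      simp [add_comm]
  choose Q hQ1 hQ using hQ'
  obtain ⟨R, hR⟩ := exists_hasSum_exp ((Polynomial.X + Polynomial.C (b : ℝ)) ^ (2 * t))
  obtain ⟨c, hc, hcR⟩ := exists_polyBounded_eval R
  refine ⟨Q, fun d => 2 * c d +
    ∑ i ∈ Finset.range t, ((2 * i).factorial : ℝ) * Real.exp (2 * b),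
    ((PolyBounded.const 2).mul hc).add (PolyBounded.const _), fun h => hQ1 0 h rfl, ?_⟩
  intro n d κ hn hκ htκ hexp
  have hn0 : (0 : ℝ) < n := by exact_mod_cast hn
  have hn1 : (1 : ℝ) ≤ n := by exact_mod_cast hn
  set y := arcDensity n d with hydef
  have hy0 : 0 ≤ y := arcDensity_nonneg n d
  have hyd : y ≤ 2 * d := arcDensity_le n d
  -- Truncated subtraction: `N = 0` when `b > κ`, and `κ ≤ N + b` holds in every case.
  set N := κ + 1 - b with hN
  let r : ℕ → ℝ := fun k => (n : ℝ) ^ k / n.descFactorial k -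
    ∑ i ∈ Finset.range t, invDescCoeff i k / (n : ℝ) ^ i
  have hdecomp : innerSum n d (κ + 1) b = (-1) ^ b * (
      ∑ i ∈ Finset.range t, (∑ l ∈ Finset.range N,
        (-y) ^ l / l.factorial * invDescCoeff i (b + l)) / (n : ℝ) ^ i +
      ∑ l ∈ Finset.range N, (-y) ^ l / l.factorial * r (b + l)) := by
    simp only [Finset.sum_div]
    rw [Finset.sum_comm, ← Finset.sum_add_distrib, innerSum, Finset.mul_sum]
    refine Finset.sum_congr rfl fun l _ => ?_
    have : ∑ i ∈ Finset.range t, (-y) ^ l / l.factorial * invDescCoeff i (b + l) / (n : ℝ) ^ i =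
        (-y) ^ l / l.factorial * ∑ i ∈ Finset.range t, invDescCoeff i (b + l) / (n : ℝ) ^ i := by
      rw [Finset.mul_sum]
      exact Finset.sum_congr rfl fun i _ => by ring
    rw [this, neg_pow, pow_add]
    simp only [r]
    ring
  have hrem : |∑ l ∈ Finset.range N, (-y) ^ l / l.factorial * r (b + l)| ≤
      2 * c d * Real.exp (2 * d) / (n : ℝ) ^ t := by
    refine (Finset.abs_sum_le_sum_abs _ _).trans ?_
    refine (Finset.sum_le_sum (g := fun l : ℕ => 2 / (n : ℝ) ^ t * (y ^ l / l.factorial *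
      ((Polynomial.X + Polynomial.C (b : ℝ)) ^ (2 * t)).eval (l : ℝ))) fun l hl => ?_).trans ?_
    · have hl := Finset.mem_range.1 hl
      have h1 : (b + l) ^ 2 ≤ κ ^ 2 := Nat.pow_le_pow_left (by omega) 2
      have h2 := pow_div_descFactorial_expansion (k := b + l) hn (by omega) t
      rw [abs_mul, abs_div, abs_pow, abs_neg, abs_of_nonneg hy0, Nat.abs_cast,
        abs_of_nonneg h2.1]
      calc y ^ l / l.factorial * r (b + l)
          ≤ y ^ l / l.factorial * (2 * (((b + l : ℕ) : ℝ) ^ 2 / n) ^ t) := by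
            gcongr
            exact h2.2
        _ = _ := by
          simp only [Polynomial.eval_pow, Polynomial.eval_add, Polynomial.eval_X,
            Polynomial.eval_C]
          rw [div_pow, pow_mul]
          push_cast
          ring
    · rw [← Finset.mul_sum]
      have h3 : ∑ l ∈ Finset.range N, (y ^ l / l.factorial *
          ((Polynomial.X + Polynomial.C (b : ℝ)) ^ (2 * t)).eval (l : ℝ)) ≤
          R.eval y * Real.exp y := by
        refine sum_le_hasSum _ (fun l _ => ?_) (hR y)
        simp only [Polynomial.eval_pow, Polynomial.eval_add, Polynomial.eval_X, Polynomial.eval_C]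
        positivity
      have h4 : R.eval y ≤ c d := (le_abs_self _).trans (hcR d y (by rwa [abs_of_nonneg hy0]))
      have h5 : 0 ≤ c d := (abs_nonneg _).trans (hcR d y (by rwa [abs_of_nonneg hy0]))
      have h6 : R.eval y * Real.exp y ≤ c d * Real.exp (2 * d) := by gcongr
      calc _ ≤ 2 / (n : ℝ) ^ t * (c d * Real.exp (2 * d)) := by
            gcongr
            exact h3.trans h6
        _ = _ := by ring
  have htail : ∀ i ∈ Finset.range t, |(∑ l ∈ Finset.range N,
      (-y) ^ l / l.factorial * invDescCoeff i (b + l)) / (n : ℝ) ^ i -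
      (Q i).eval (-y) * Real.exp (-y) / (n : ℝ) ^ i| ≤
      ((2 * i).factorial : ℝ) * Real.exp (2 * b) * Real.exp (2 * d) / (n : ℝ) ^ t := by
    intro i _
    have h1 := abs_series_tail_le (κ := κ) (N := N) (b := b) (by omega) hy0 hyd (hQ i (-y))
    have hni : (1 : ℝ) ≤ (n : ℝ) ^ i := one_le_pow₀ hn1
    rw [← sub_div, abs_div, abs_sub_comm, abs_of_pos (by positivity : (0 : ℝ) < (n : ℝ) ^ i)]
    refine (div_le_self (abs_nonneg _) hni).trans (h1.trans ?_)
    have he : 1 ≤ Real.exp (2 * d) := Real.one_le_exp (by positivity)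
    calc _ ≤ ((2 * i).factorial : ℝ) * Real.exp (2 * b) * (1 / (n : ℝ) ^ t) := by gcongr
      _ = ((2 * i).factorial : ℝ) * Real.exp (2 * b) * 1 / (n : ℝ) ^ t := by ring
      _ ≤ _ := by gcongr
  have hfinal : innerSum n d (κ + 1) b - (-1) ^ b * Real.exp (-y) *
      ∑ i ∈ Finset.range t, (Q i).eval (-y) / (n : ℝ) ^ i = (-1) ^ b * (
      ∑ i ∈ Finset.range t, ((∑ l ∈ Finset.range N,
        (-y) ^ l / l.factorial * invDescCoeff i (b + l)) / (n : ℝ) ^ i -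
        (Q i).eval (-y) * Real.exp (-y) / (n : ℝ) ^ i) +
      ∑ l ∈ Finset.range N, (-y) ^ l / l.factorial * r (b + l)) := by
    rw [hdecomp, Finset.sum_sub_distrib, mul_assoc, Finset.mul_sum]
    have : ∑ i ∈ Finset.range t, Real.exp (-y) * ((Q i).eval (-y) / (n : ℝ) ^ i) =
        ∑ i ∈ Finset.range t, (Q i).eval (-y) * Real.exp (-y) / (n : ℝ) ^ i :=
      Finset.sum_congr rfl fun i _ => by ring
    rw [this]
    ring
  rw [hfinal, abs_mul, abs_pow, abs_neg, abs_one, one_pow, one_mul]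
  refine (abs_add_le _ _).trans ?_
  have h1 := (Finset.abs_sum_le_sum_abs _ _).trans (Finset.sum_le_sum htail)
  rw [← Finset.sum_div, ← Finset.sum_mul] at h1
  refine (add_le_add h1 hrem).trans (le_of_eq ?_)
  ring

/-! ### The main term in powers of `1 / n` -/

theorem arcDensity_eq {n d : ℕ} (hn : 0 < n) (hd : d ≤ n) :
    arcDensity n d = 2 * d - d * (d + 1) / n := by
  have hn0 : (0 : ℝ) < n := by exact_mod_cast hn
  rw [arcDensity, card_arcs_eq hd]
  field_simp

theorem polyBounded_mul_succ : PolyBounded fun d : ℕ => (d : ℝ) * (d + 1) :=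
  PolyBounded.id.mul (PolyBounded.id.add (PolyBounded.const 1))

theorem le_of_polyBound_one_le {n d : ℕ} (h : polyBound 1 d ≤ n) : d ≤ n ∧ 0 < n := by
  simp only [polyBound, pow_one, one_mul] at h
  omega

theorem expandable_arcDensity (t : ℕ) : Expandable t fun d n => arcDensity n d := by
  refine ((Expandable.const ((PolyBounded.const 2).mul PolyBounded.id) t).add
    (Expandable.const ((PolyBounded.const (-1)).mul polyBounded_mul_succ) t).div_nat).congr 1
    fun d n hn => ?_
  obtain ⟨h1, h2⟩ := le_of_polyBound_one_le hn
  rw [arcDensity_eq h2 h1]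
  ring

theorem expandable_centredCount (b t : ℕ) :
    Expandable t fun d n => centredCount n d b / (n : ℝ) ^ (b / 2) := by
  have hstart : ∀ j : ℕ, PolyBounded fun d : ℕ => ((b * (b * d) + d + j : ℕ) : ℝ) := by
    intro j
    push_cast
    exact (((PolyBounded.const _).mul ((PolyBounded.const _).mul PolyBounded.id)).add
      PolyBounded.id).add (PolyBounded.const _)
  have hval : ∀ i : ℕ, PolyBounded fun d : ℕ => centredCount (b * (b * d) + d + i) d b := fun i =>
    ((((PolyBounded.const (32 * b)).mul (PolyBounded.id.add (PolyBounded.const 1))).pow b).mul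
      ((hstart i).pow (b / 2))).of_le fun d => abs_centredCount_le _ d b
  have hmain : Expandable t fun d n => ∑ i ∈ Finset.range (b / 2 + 1),
      centredCount (b * (b * d) + d + i) d b *
        ∏ j ∈ (Finset.range (b / 2 + 1)).erase i,
          (((i : ℝ) - j)⁻¹ * (1 + (-1 * ((b * (b * d) + d + j : ℕ) : ℝ)) / n)) :=
    Expandable.sum _ fun i _ => (Expandable.const (hval i) t).mul (Expandable.prod _ fun j _ =>
      (Expandable.const (PolyBounded.const _) t).mul ((Expandable.const (PolyBounded.const 1) t).add
        (Expandable.const ((PolyBounded.const (-1)).mul (hstart j)) t).div_nat))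
  refine hmain.congr (b * b + 1) fun d n hn => ?_
  have h1 := le_polyBound (b * b + 1) d
  have hn0 : (0 : ℝ) < n := by exact_mod_cast (by omega : 0 < n)
  have hle : b * (b * d) + d ≤ n := by
    refine le_trans ?_ hn
    calc b * (b * d) + d = (b * b + 1) * d := by ring
      _ ≤ (b * b + 1) * (d + 1) ^ (b * b + 1) := by
        gcongr
        exact (Nat.le_succ d).trans (Nat.le_self_pow (by omega) _)
  rw [centredCount_eq_interpolation hle, Finset.sum_div]
  refine Finset.sum_congr rfl fun i hi => ?_
  rw [mul_div_assoc]
  congr 1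
  have hcard : ((Finset.range (b / 2 + 1)).erase i).card = b / 2 := by
    rw [Finset.card_erase_of_mem hi, Finset.card_range, Nat.add_sub_cancel]
  have hpow : (n : ℝ) ^ (b / 2) = ∏ _j ∈ (Finset.range (b / 2 + 1)).erase i, (n : ℝ) := by
    rw [Finset.prod_const, hcard]
  rw [div_eq_iff (by positivity), hpow, ← Finset.prod_mul_distrib]
  refine Finset.prod_congr rfl fun j _ => ?_
  field_simp
  ring

theorem normCount_zero (n d : ℕ) : normCount n d 0 = 1 := by
  simp [normCount, centredCount, card_forests_zero]

/-- For `b ≥ 1` one has `b / 2 ≤ b - 1`, so a factor `1 / n` can be split off: nonempty clusters do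
not affect the leading term. -/
theorem expandable_mul_normCount {b : ℕ} (hb : b ≠ 0) (t : ℕ) :
    Expandable t fun d n => n * normCount n d b := by
  have h := ((expandable_centredCount b t).mul ((Expandable.const (PolyBounded.const 1) t).div_nat.pow
    (b - 1 - b / 2))).mul (Expandable.const (PolyBounded.const ((b.factorial : ℝ)⁻¹)) t)
  refine h.congr 1 fun d n hn => ?_
  have hn0 : (0 : ℝ) < n := by exact_mod_cast (le_of_polyBound_one_le hn).2
  have hp : (n : ℝ) ^ b = n * ((n : ℝ) ^ (b / 2) * (n : ℝ) ^ (b - 1 - b / 2)) := by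
    rw [← pow_add, ← pow_succ']
    congr 1
    omega
  rw [normCount, hp, div_pow, one_pow]
  field_simp

/-- The term `b = i = 0` contributes exactly `1`, every other term carries a factor `1 / n`, and
`exp (-arcDensity n d)` is `e ^ (-2d)` times `exp (d (d + 1) / n)`. -/
theorem expandable_main_factor {t : ℕ} (ht : 0 < t) (s : ℕ) {Q : ℕ → ℕ → Polynomial ℝ}
    (hQ : Q 0 0 = 1) :
    ∃ ψ : ℕ → ℕ → ℝ, Expandable s ψ ∧ ∀ d n, polyBound 1 d ≤ n →
      ∑ b ∈ Finset.range (2 * t), normCount n d b * ((-1) ^ b * Real.exp (-arcDensity n d) *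
        ∑ i ∈ Finset.range t, (Q b i).eval (-arcDensity n d) / (n : ℝ) ^ i) =
      (1 + ψ d n / n) * Real.exp (-2 * d) := by
  obtain ⟨t, rfl⟩ : ∃ t', t = t' + 1 := ⟨t - 1, by omega⟩
  have hy : Expandable s fun d n => -1 * arcDensity n d :=
    (Expandable.const (PolyBounded.const (-1)) s).mul (expandable_arcDensity s)
  have hQe : ∀ b i j, Expandable s fun d n => (Q b i).eval (-1 * arcDensity n d) * (1 / n) ^ j :=
    fun b i j => (hy.polynomial (Q b i)).mul
      ((Expandable.const (PolyBounded.const 1) s).div_nat.pow j)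
  -- `W` is defined by `1 + W / n = exp (d (d + 1) / n)`, and `R` collects the remaining factor as
  -- `1 + R / n`.
  let W : ℕ → ℕ → ℝ := fun d n => n * (Real.exp ((d : ℝ) * (d + 1) / n) - 1)
  have hW : Expandable s W := Expandable.exp_sub_one polyBounded_mul_succ s
  let R : ℕ → ℕ → ℝ := fun d n =>
    (∑ i ∈ Finset.range t, (Q 0 (i + 1)).eval (-1 * arcDensity n d) * (1 / n) ^ i) +
    ∑ b ∈ Finset.range (2 * t + 1), (n * normCount n d (b + 1)) * ((-1) ^ (b + 1) *
      ∑ i ∈ Finset.range (t + 1), (Q (b + 1) i).eval (-1 * arcDensity n d) * (1 / n) ^ i)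
  have hR : Expandable s R :=
    (Expandable.sum _ fun i _ => hQe 0 (i + 1) i).add (Expandable.sum _ fun b _ =>
      (expandable_mul_normCount b.succ_ne_zero s).mul
        ((Expandable.const (PolyBounded.const _) s).mul (Expandable.sum _ fun i _ => hQe _ i i)))
  refine ⟨fun d n => W d n + R d n + W d n * R d n / n, (hW.add hR).add (hW.mul hR).div_nat, ?_⟩
  intro d n hn
  obtain ⟨hdn, hn⟩ := le_of_polyBound_one_le hn
  have hn0 : (0 : ℝ) < n := by exact_mod_cast hn
  have hexp : Real.exp (-arcDensity n d) = Real.exp (-2 * d) * (1 + W d n / n) := by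
    have : 1 + W d n / n = Real.exp ((d : ℝ) * (d + 1) / n) := by
      simp only [W]
      field_simp
      ring
    rw [this, ← Real.exp_add, arcDensity_eq hn hdn]
    congr 1
    ring
  have hsum : ∑ b ∈ Finset.range (2 * (t + 1)), normCount n d b * ((-1) ^ b *
      ∑ i ∈ Finset.range (t + 1), (Q b i).eval (-arcDensity n d) / (n : ℝ) ^ i) =
      1 + R d n / n := by
    rw [show 2 * (t + 1) = (2 * t + 1) + 1 by ring, Finset.sum_range_succ', normCount_zero,
      Finset.sum_range_succ' _ t, hQ]
    simp only [R, neg_one_mul, pow_zero, one_mul, Polynomial.eval_one, div_one, add_div,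
      Finset.sum_div, Finset.mul_sum]
    have e1 : ∀ i ∈ Finset.range t, (Q 0 (i + 1)).eval (-arcDensity n d) / (n : ℝ) ^ (i + 1) =
        (Q 0 (i + 1)).eval (-arcDensity n d) * (1 / n) ^ i / n := by
      intro i _
      rw [div_pow, one_pow, pow_succ]
      field_simp
    have e2 : ∀ b ∈ Finset.range (2 * t + 1), ∀ i ∈ Finset.range (t + 1),
        normCount n d (b + 1) * ((-1) ^ (b + 1) *
          ((Q (b + 1) i).eval (-arcDensity n d) / (n : ℝ) ^ i)) =
        n * normCount n d (b + 1) * ((-1) ^ (b + 1) *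
          ((Q (b + 1) i).eval (-arcDensity n d) * (1 / n) ^ i)) / n := by
      intro b _ i _
      rw [div_pow, one_pow]
      field_simp
    rw [Finset.sum_congr rfl e1, Finset.sum_congr rfl fun b hb => Finset.sum_congr rfl (e2 b hb)]
    ring
  have hfact : ∑ b ∈ Finset.range (2 * (t + 1)), normCount n d b *
      ((-1) ^ b * Real.exp (-arcDensity n d) *
        ∑ i ∈ Finset.range (t + 1), (Q b i).eval (-arcDensity n d) / (n : ℝ) ^ i) =
      Real.exp (-arcDensity n d) * (1 + R d n / n) := by
    rw [← hsum, Finset.mul_sum]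
    exact Finset.sum_congr rfl fun b _ => by ring
  rw [hfact, hexp]
  ring

theorem exists_approximation (t : ℕ) :
    ∃ (Q : ℕ → ℕ → Polynomial ℝ) (q : ℕ → ℝ), PolyBounded q ∧ Q 0 0 = 1 ∧
      ∀ n d κ : ℕ, 2 ≤ n → 2 * κ ^ 2 ≤ n → 2 * t ≤ κ →
        32 * Real.exp 1 * (d + 1) / √n ≤ 1 / 2 →
        Real.exp (Real.exp 2 * (2 * d) - κ) ≤ 1 / (n : ℝ) ^ t →
        |probMinJumpGe n (d + 1) - ∑ b ∈ Finset.range (2 * t), normCount n d b *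
          ((-1) ^ b * Real.exp (-arcDensity n d) *
            ∑ i ∈ Finset.range t, (Q b i).eval (-arcDensity n d) / (n : ℝ) ^ i)| ≤
          q d * Real.exp (2 * d) / (n : ℝ) ^ t := by
  choose Q c hc hQ h using exists_small_clusters t
  refine ⟨Q, fun d => 1 + 4 * (32 * Real.exp 1 * (d + 1)) ^ (2 * t) +
    ∑ b ∈ Finset.range (2 * t), c b d, ?_, hQ 0 rfl, ?_⟩
  · exact ((PolyBounded.const 1).add ((PolyBounded.const 4).mul (((PolyBounded.const _).mul
      (PolyBounded.id.add (PolyBounded.const 1))).pow _))).add (PolyBounded.sum _ fun b _ => hc b)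
  intro n d κ hn2 hκ htκ hρ hexp
  have hn : 0 < n := by omega
  have hn0 : (0 : ℝ) < n := by exact_mod_cast hn
  have hκn : κ ≤ n := by nlinarith
  have e1 := (abs_truncation_le (d := d) hn hκn).trans hexp
  have e2 := abs_large_clusters_le hn hκ htκ hρ
  rw [sum_range_eq_innerSum hn d (κ + 1)] at e1
  rw [probMinJumpGe_eq hn2]
  have e3 : |∑ b ∈ Finset.range (2 * t), normCount n d b * innerSum n d (κ + 1) b -
      ∑ b ∈ Finset.range (2 * t), normCount n d b *
          ((-1) ^ b * Real.exp (-arcDensity n d) *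
            ∑ i ∈ Finset.range t, (Q b i).eval (-arcDensity n d) / (n : ℝ) ^ i)| ≤
      ∑ b ∈ Finset.range (2 * t), c b d * Real.exp (2 * d) / (n : ℝ) ^ t := by
    rw [← Finset.sum_sub_distrib]
    refine (Finset.abs_sum_le_sum_abs _ _).trans (Finset.sum_le_sum fun b _ => ?_)
    rw [← mul_sub, abs_mul]
    have h1 := abs_normCount_le hn d b
    have h2 : (32 * Real.exp 1 * (d + 1) / √n) ^ b ≤ 1 :=
      pow_le_one₀ (by positivity) (by linarith)
    calc _ ≤ 1 * _ := mul_le_mul_of_nonneg_right (h1.trans h2) (abs_nonneg _)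
      _ ≤ _ := by
        rw [one_mul]
        exact h b n d κ hn hκ htκ hexp
  rw [← Finset.sum_div, ← Finset.sum_mul] at e3
  have he : 1 / (n : ℝ) ^ t ≤ Real.exp (2 * d) / (n : ℝ) ^ t := by
    gcongr
    exact Real.one_le_exp (by positivity)
  have habs := (abs_sub_le _ _ _).trans (add_le_add ((abs_sub_le _ _ _).trans (add_le_add e1 e2)) e3)
  refine habs.trans ?_
  refine (add_le_add_left (add_le_add_left he _) _).trans (le_of_eq ?_)
  ring

/-- For `d ≤ C log n`, this turns conditions of the form "`n` exceeds a polynomial in `d`" into "`n`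
is large". -/
theorem eventually_log_pow_le (a b : ℝ) (k : ℕ) :
    ∀ᶠ n : ℕ in Filter.atTop, (|a| * Real.log n + |b|) ^ k ≤ n := by
  have h1 := (Real.isLittleO_pow_log_id_atTop (n := k)).bound
    (by positivity : 0 < 1 / ((|a| + |b|) ^ k + 1))
  have h2 := tendsto_natCast_atTop_atTop.eventually h1
  filter_upwards [h2, Filter.eventually_ge_atTop 3] with n hn hn3
  have hn3' : (3 : ℝ) ≤ n := by exact_mod_cast hn3
  have hlog : 1 ≤ Real.log n := by
    rw [Real.le_log_iff_exp_le (by linarith)]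
    exact Real.exp_one_lt_three.le.trans hn3'
  simp only [id, Real.norm_eq_abs, Nat.abs_cast] at hn
  rw [abs_of_nonneg (by positivity)] at hn
  have h3 : |a| * Real.log n + |b| ≤ (|a| + |b|) * Real.log n := by
    nlinarith [abs_nonneg b]
  have hp : 0 < (|a| + |b|) ^ k + 1 := by positivity
  rw [one_div, inv_mul_eq_div, le_div_iff₀ hp] at hn
  calc (|a| * Real.log n + |b|) ^ k ≤ ((|a| + |b|) * Real.log n) ^ k := by gcongr
    _ = Real.log n ^ k * (|a| + |b|) ^ k := by
      rw [mul_pow]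
      ring
    _ ≤ Real.log n ^ k * ((|a| + |b|) ^ k + 1) := by gcongr; linarith
    _ ≤ n := hn

theorem theorem2 (t : ℕ) (ht : 1 ≤ t) :
    ∃ (p : ℕ → ℕ → ℝ) (q : ℕ → ℝ),
      (∀ i ∈ Finset.Icc 1 (t - 1), PolynomiallyBounded (p i)) ∧
      PolynomiallyBounded q ∧
      ∀ C : ℝ, ∃ (A : ℝ) (N : ℕ), ∀ n : ℕ, N ≤ n → 2 ≤ n →
        ∀ d : ℕ, (d : ℝ) ≤ C * Real.log (n : ℝ) →
          |probMinJumpGe n (d + 1) -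
              (1 + ∑ i ∈ Finset.Icc 1 (t - 1), p i d / (n : ℝ) ^ i) * Real.exp (-2 * (d : ℝ))|
            ≤ A * |q d * Real.exp (2 * (d : ℝ)) / (n : ℝ) ^ t| := by
  obtain ⟨Q, q, hq, hQ, happ⟩ := exists_approximation t
  obtain ⟨ψ, hψ, hmain⟩ := expandable_main_factor ht (t - 1) hQ
  obtain ⟨c, K, hc, hcoef⟩ := hψ.exists_coeff
  -- The correction is `ψ / n`, so indices shift by one and expanding `ψ` to order `t - 1` suffices.
  -- Its remainder is added to the error function.
  refine ⟨fun i => c (i - 1), fun d => q d + polyBound K d,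
    fun i _ => (hc _).polynomiallyBounded,
    (hq.add ⟨K, fun d => by simp⟩).polynomiallyBounded, fun C => ?_⟩
  -- Chosen so that `κ ≥ E log n` gives `2 e² d - κ ≤ -t log n` whenever `d ≤ |C| log n`.
  set E : ℝ := t + 2 * Real.exp 2 * |C| with hE
  have hE0 : 0 ≤ E := by positivity
  have hev : ∀ᶠ n : ℕ in Filter.atTop, ∀ d : ℕ, 2 ≤ n → (d : ℝ) ≤ C * Real.log n →
      (∃ κ : ℕ, 2 * κ ^ 2 ≤ n ∧ 2 * t ≤ κ ∧
        Real.exp (Real.exp 2 * (2 * d) - κ) ≤ 1 / (n : ℝ) ^ t) ∧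
      32 * Real.exp 1 * (d + 1) / √n ≤ 1 / 2 ∧ polyBound K d ≤ n ∧ polyBound 1 d ≤ n := by
    filter_upwards [eventually_log_pow_le (2 * E) (2 * (2 * t + 1)) 2,
      eventually_log_pow_le (64 * Real.exp 1 * C) (64 * Real.exp 1) 2,
      eventually_log_pow_le (((K : ℝ) + 1) * C) ((K : ℝ) + 1) (K + 1)] with n h1 h2 h3 d hn hd
    have hn0 : (0 : ℝ) < n := by exact_mod_cast (by omega : 0 < n)
    have hlog : 0 ≤ Real.log n := Real.log_natCast_nonneg n
    have hd' : (d : ℝ) ≤ |C| * Real.log n :=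
      hd.trans (mul_le_mul_of_nonneg_right (le_abs_self C) hlog)
    have hpoly : ((K : ℝ) + 1) ^ (K + 1) * (d + 1) ^ (K + 1) ≤ n := by
      rw [← mul_pow]
      refine le_trans ?_ h3
      rw [abs_mul, abs_of_pos (by positivity : (0 : ℝ) < (K : ℝ) + 1), mul_assoc, ← mul_add_one]
      gcongr
    have hpoly' : (K + 1) ^ (K + 1) * (d + 1) ^ (K + 1) ≤ n := by exact_mod_cast hpoly
    refine ⟨⟨⌈E * Real.log n⌉₊ + 2 * t, ?_, by omega, ?_⟩, ?_, ?_, ?_⟩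
    · have h4 := Nat.ceil_lt_add_one (mul_nonneg hE0 hlog)
      rw [abs_of_nonneg (by positivity), abs_of_nonneg (by positivity)] at h1
      have h5 : (2 * (⌈E * Real.log n⌉₊ + 2 * t : ℝ)) ^ 2 ≤ n := by
        refine le_trans ?_ h1
        gcongr
        linarith
      have h6 : (2 * (⌈E * Real.log n⌉₊ + 2 * t)) ^ 2 ≤ n := by exact_mod_cast h5
      nlinarith
    · have h4 := Nat.le_ceil (E * Real.log n)
      rw [one_div, ← Real.exp_log (by positivity : (0 : ℝ) < ((n : ℝ) ^ t)⁻¹), Real.log_inv,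
        Real.log_pow]
      apply Real.exp_le_exp.2
      push_cast
      have h5 : Real.exp 2 * (2 * d) ≤ 2 * Real.exp 2 * |C| * Real.log n := by
        have := Real.exp_pos 2
        nlinarith
      rw [hE] at h4
      have : (0 : ℝ) ≤ t := by positivity
      linarith
    · have hs : 0 < √(n : ℝ) := Real.sqrt_pos.2 hn0
      rw [div_le_iff₀ hs]
      rw [abs_mul, abs_of_pos (by positivity : (0 : ℝ) < 64 * Real.exp 1), mul_assoc,
        ← mul_add_one] at h2
      have h4 := Real.le_sqrt_of_sq_le h2
      have h5 : 64 * Real.exp 1 * (d + 1) ≤ 64 * Real.exp 1 * (|C| * Real.log n + 1) := by gcongr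
      linarith
    · refine le_trans ?_ hpoly'
      unfold polyBound
      gcongr
      · exact (Nat.le_succ K).trans (Nat.le_self_pow (by omega) _)
      · omega
      · omega
    · refine le_trans ?_ hpoly'
      unfold polyBound
      rw [one_mul, pow_one]
      exact (Nat.le_self_pow (by omega) _).trans (Nat.le_mul_of_pos_left _ (by positivity))
  obtain ⟨N, hN⟩ := Filter.eventually_atTop.1 hev
  -- All constants are already inside `q`; only `N` depends on `C`.
  refine ⟨1, N, fun n hNn hn d hd => ?_⟩
  obtain ⟨⟨κ, hκ, htκ, hexp⟩, hρ, hK, h1⟩ := hN n hNn d hn hd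
  have hn0 : (0 : ℝ) < n := by exact_mod_cast (by omega : 0 < n)
  have e1 := happ n d κ hn hκ htκ hρ hexp
  rw [hmain d n h1] at e1
  have e2 := hcoef d n hK
  have hsum : ∑ i ∈ Finset.Icc 1 (t - 1), c (i - 1) d / (n : ℝ) ^ i =
      (∑ i ∈ Finset.range (t - 1), c i d / (n : ℝ) ^ i) / n := by
    rw [Finset.sum_div]
    induction t - 1 with
    | zero => simp
    | succ s ih =>
      rw [Finset.sum_Icc_succ_top (by omega), ih, Finset.sum_range_succ, Nat.add_sub_cancel,
        pow_succ, div_div]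
  have e3 : |(1 + ψ d n / n) * Real.exp (-2 * d) -
      (1 + ∑ i ∈ Finset.Icc 1 (t - 1), c (i - 1) d / (n : ℝ) ^ i) * Real.exp (-2 * d)| ≤
      polyBound K d * Real.exp (2 * d) / (n : ℝ) ^ t := by
    rw [hsum, ← sub_mul, add_sub_add_left_eq_sub, ← sub_div, abs_mul, abs_div, Nat.abs_cast,
      Real.abs_exp]
    have hle : Real.exp (-2 * d) ≤ Real.exp (2 * d) := by
      apply Real.exp_le_exp.2
      have : (0 : ℝ) ≤ d := by positivity
      linarith
    calc _ ≤ (polyBound K d / (n : ℝ) ^ (t - 1)) / n * Real.exp (2 * d) := by gcongr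
      _ = _ := by
        obtain ⟨s, rfl⟩ : ∃ s, t = s + 1 := ⟨t - 1, by omega⟩
        rw [Nat.add_sub_cancel, pow_succ]
        field_simp
  rw [one_mul]
  refine le_trans ?_ (le_abs_self _)
  refine (abs_sub_le _ _ _).trans ((add_le_add e1 e3).trans (le_of_eq ?_))
  ring
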